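/- All systems are finite-dimensional complex Hilbert spaces. A state is a positive semidefinite operator of trace one. For a state $\rho$ and $\alpha\ge 0$, $S_\alpha(\rho)$ is the Rényi entropy of order $\alpha$: $S_1(\rho)=-\operatorname{Tr}[\rho\log_2\rho]$ (von Neumann entropy), and $S_\alpha(\rho)=\frac{1}{1-\alpha}\log_2\sum_{\lambda\neq0}\lambda^\alpha$ for $\alpha\ne1$, the sum being over the nonzero eigenvalues $\lambda$ of $\rho$ with multiplicity. Let $\sigma_{B_0B_1}$ be a bipartite state. Given nonzero systems $A_0,A_1$, a pair of unitary operators $U_0$ on $A_0\otimes B_0$ and $U_1$ on $A_1\otimes B_1$ is *compatible* with $\sigma$ if $$\operatorname{Tr}_{A_0A_1}\big[(U_0\otimes U_1)(\rho_{A_0A_1}\otimes\sigma_{B_0B_1})(U_0\otimes U_1)^\dagger\big]=\sigma_{B_0B_1}\quad\text{for every state }\rho_{A_0A_1};$$ it then implements the channel $\mathcal N(\rho)=\operatorname{Tr}_{B_0B_1}[(U_0\otimes U_1)(\rho\otimes\sigma)(U_0\otimes U_1)^\dagger]$ on $A_0A_1$. *Randomness of order $\alpha$ can be catalytically extracted from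 $\sigma$* if there are nonzero $A_0,A_1$, a compatible pair $(U_0,U_1)$ and a state $\rho_{A_0A_1}$ with $S_\alpha(\mathcal N(\rho))>S_\alpha(\rho)$. The state $\sigma$ is *PC-Q* if there is a projective measurement $\{\Pi_i\}_{i=1}^n$ on $B_0$ with $n>1$ (nonzero, mutually orthogonal projectors with sum $\mathbb 1$) such that $\sigma=\sum_i(\Pi_i\otimes\mathbb 1)\sigma(\Pi_i\otimes\mathbb 1)$; *Q-PC* is the same with the roles of $B_0$ and $B_1$ exchanged; $\sigma$ is *TQ-TQ* if it is neither PC-Q nor Q-PC. **Theorem.** 1. For every bipartite state $\sigma_{B_0B_1}$: every compatible pair $(U_0,U_1)$, for all nonzero $A_0,A_1$, consists of product unitaries ($U_j=W_j\otimes V_j$ with $W_j$ unitary on $A_j$ and $V_j$ unitary on $B_j$) if and only if $\sigma$ is TQ-TQ. 2. If both marginals of $\sigma_{B_0B_1}$ have full rank, then for every $\alpha\ge0$: no randomness of order $\alpha$ can be catalytically extracted from $\sigma$ if and only if $\sigma$ is TQ-TQ. 3. For an arbitrary $\sigma_{B_0B_1}$ and every $\alpha\ge0$: no randomness of order $\alpha$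 can be catalytically extracted from $\sigma$ if and only if $\sigma$, regarded as a state on $\operatorname{supp}\sigma_{B_0}\otimes\operatorname{supp}\sigma_{B_1}$, is TQ-TQ. (That is: if $\sigma=(V_0\otimes V_1)\tau(V_0\otimes V_1)^\dagger$ with isometries $V_0,V_1$ and a state $\tau$ with full-rank marginals, the condition is that $\tau$ is TQ-TQ.) 4. In particular some mixed states are useless as catalytic randomness sources: there is a two-qubit state that is not pure, has full-rank marginals, and from which no randomness of any order $\alpha\ge0$ can be catalytically extracted. -/

import Mathlib

open scoped Kronecker ComplexOrder

noncomputable section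

namespace CatalyticRandomness

/-- A quantum state of a finite-dimensional system with orthonormal basis indexed by `X`:
a positive semidefinite matrix of trace one. -/
structure State (X : Type*) [Fintype X] where
  mat : Matrix X X ℂ
  posSemidef : mat.PosSemidef
  trace_eq_one : mat.trace = 1

/-- Partial trace over the left tensor factor. -/
def traceLeft {X Y : Type*} [Fintype X] (M : Matrix (X × Y) (X × Y) ℂ) : Matrix Y Y ℂ :=
  Matrix.of fun y y' => ∑ x, M (x, y) (x, y')

/-- Partial trace over the right tensor factor. -/
def traceRight {X Y : Type*} [Fintype Y] (M : Matrix (X × Y) (X × Y) ℂ) : Matrix X X ℂ :=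
  Matrix.of fun x x' => ∑ y, M (x, y) (x', y)

/-- A state is pure if it is of the form `|ψ⟩⟨ψ|` (trace one forces `ψ` to be a unit vector). -/
def State.IsPure {X : Type*} [Fintype X] (ρ : State X) : Prop :=
  ∃ ψ : X → ℂ, ρ.mat = Matrix.vecMulVec ψ (star ψ)

/-- The Rényi entropy (in bits) of order `α` of a state; for `α = 1` the von Neumann entropy
`-Tr[ρ log₂ ρ]`. The sum runs over the nonzero eigenvalues with multiplicity, so order `0` gives
the logarithm of the rank. -/
def State.renyiEntropy {X : Type*} [Fintype X] [DecidableEq X] (α : ℝ) (ρ : State X) : ℝ :=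
  if α = 1 then
    ∑ i, -(ρ.posSemidef.isHermitian.eigenvalues i
      * Real.logb 2 (ρ.posSemidef.isHermitian.eigenvalues i))
  else
    1 / (1 - α) * Real.logb 2 (∑ i with ρ.posSemidef.isHermitian.eigenvalues i ≠ 0,
      ρ.posSemidef.isHermitian.eigenvalues i ^ α)

section Catalysis

variable {A₀ A₁ B₀ B₁ : Type*} [Fintype A₀] [Fintype A₁] [Fintype B₀] [Fintype B₁]

/-- `U₀ ⊗ U₁` with `U₀` acting on `A₀ B₀` and `U₁` acting on `A₁ B₁`, the tensor factors
being rearranged in the order `(A₀ A₁)(B₀ B₁)`. -/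
def jointOp (U₀ : Matrix (A₀ × B₀) (A₀ × B₀) ℂ) (U₁ : Matrix (A₁ × B₁) (A₁ × B₁) ℂ) :
    Matrix ((A₀ × A₁) × (B₀ × B₁)) ((A₀ × A₁) × (B₀ × B₁)) ℂ :=
  (U₀ ⊗ₖ U₁).submatrix (Equiv.prodProdProdComm A₀ A₁ B₀ B₁) (Equiv.prodProdProdComm A₀ A₁ B₀ B₁)

/-- The global state after the local interactions, `Ad_{U₀ ⊗ U₁}(ρ ⊗ σ)`. -/
def evolve (U₀ : Matrix (A₀ × B₀) (A₀ × B₀) ℂ) (U₁ : Matrix (A₁ × B₁) (A₁ × B₁) ℂ)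
    (ρ : State (A₀ × A₁)) (σ : State (B₀ × B₁)) :
    Matrix ((A₀ × A₁) × (B₀ × B₁)) ((A₀ × A₁) × (B₀ × B₁)) ℂ :=
  jointOp U₀ U₁ * (ρ.mat ⊗ₖ σ.mat) * (jointOp U₀ U₁).conjTranspose

/-- The pair `(U₀, U₁)` is compatible with the delocalized randomness source `σ`: whatever the
initial state of `A₀ A₁`, the source is returned unchanged. -/
def Compatible (U₀ : Matrix (A₀ × B₀) (A₀ × B₀) ℂ) (U₁ : Matrix (A₁ × B₁) (A₁ × B₁) ℂ)
    (σ : State (B₀ × B₁)) : Prop :=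
  ∀ ρ : State (A₀ × A₁), traceLeft (evolve U₀ U₁ ρ σ) = σ.mat

theorem traceRight_posSemidef {X Y : Type*} [Fintype X] [Fintype Y]
    {M : Matrix (X × Y) (X × Y) ℂ} (hM : M.PosSemidef) : (traceRight M).PosSemidef := by
  have h : traceRight M = ∑ y, M.submatrix (fun x => (x, y)) (fun x => (x, y)) := by
    ext x x'
    simp [traceRight, Matrix.sum_apply]
  rw [h]
  exact Matrix.posSemidef_sum _ fun y _ => hM.submatrix _

theorem trace_traceRight {X Y : Type*} [Fintype X] [Fintype Y]
    (M : Matrix (X × Y) (X × Y) ℂ) : (traceRight M).trace = M.trace := by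
  simp [traceRight, Matrix.trace, Fintype.sum_prod_type]

variable [DecidableEq A₀] [DecidableEq A₁] [DecidableEq B₀] [DecidableEq B₁]

theorem jointOp_mem {U₀ : Matrix (A₀ × B₀) (A₀ × B₀) ℂ} {U₁ : Matrix (A₁ × B₁) (A₁ × B₁) ℂ}
    (h₀ : U₀ ∈ Matrix.unitaryGroup (A₀ × B₀) ℂ) (h₁ : U₁ ∈ Matrix.unitaryGroup (A₁ × B₁) ℂ) :
    (jointOp U₀ U₁).conjTranspose * jointOp U₀ U₁ = 1 := by
  have h := Matrix.mem_unitaryGroup_iff'.1 (Matrix.kronecker_mem_unitary h₀ h₁)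
  rw [Matrix.star_eq_conjTranspose] at h
  rw [jointOp, Matrix.conjTranspose_submatrix, Matrix.submatrix_mul_equiv, h,
    Matrix.submatrix_one_equiv]

/-- The state of `A₀ A₁` after the catalysis,
`𝒩(ρ) = Tr_{B₀B₁}[Ad_{U₀ ⊗ U₁}(ρ ⊗ σ)]`. -/
def output (U₀ : Matrix.unitaryGroup (A₀ × B₀) ℂ) (U₁ : Matrix.unitaryGroup (A₁ × B₁) ℂ)
    (ρ : State (A₀ × A₁)) (σ : State (B₀ × B₁)) : State (A₀ × A₁) where
  mat := traceRight (evolve U₀.1 U₁.1 ρ σ)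
  posSemidef := traceRight_posSemidef
    ((ρ.posSemidef.kronecker σ.posSemidef).mul_mul_conjTranspose_same _)
  trace_eq_one := by
    rw [trace_traceRight, evolve, Matrix.trace_mul_comm, ← Matrix.mul_assoc,
      jointOp_mem U₀.2 U₁.2, Matrix.one_mul, Matrix.trace_kronecker, ρ.trace_eq_one,
      σ.trace_eq_one, one_mul]

/-- Randomness, measured by the Rényi entropy of order `α`, can be catalytically extracted from
`σ` in the delocalized setting: some local unitaries compatible with `σ`, on target systems of
some finite dimensions, increase the entropy of some initial state of the target systems. -/
def RandomnessExtractable (α : ℝ) (σ : State (B₀ × B₁)) : Prop :=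
  ∃ a₀ a₁ : ℕ, 0 < a₀ ∧ 0 < a₁ ∧
    ∃ (U₀ : Matrix.unitaryGroup (Fin a₀ × B₀) ℂ) (U₁ : Matrix.unitaryGroup (Fin a₁ × B₁) ℂ),
      Compatible U₀.1 U₁.1 σ ∧
        ∃ ρ : State (Fin a₀ × Fin a₁),
          ρ.renyiEntropy α < (output U₀ U₁ ρ σ).renyiEntropy α

/-- A unitary operator on `A B` of the form `W ⊗ V` with unitary `W`, `V`. -/
def IsProductUnitary (U : Matrix (A₀ × B₀) (A₀ × B₀) ℂ) : Prop :=
  ∃ W ∈ Matrix.unitaryGroup A₀ ℂ, ∃ V ∈ Matrix.unitaryGroup B₀ ℂ, U = W ⊗ₖ V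

/-- Every pair of local unitaries compatible with `σ` consists of product unitaries, i.e. the
target systems cannot interact with the source at all without altering it. -/
def OnlyProductCompatible (σ : State (B₀ × B₁)) : Prop :=
  ∀ a₀ a₁ : ℕ, 0 < a₀ → 0 < a₁ →
    ∀ (U₀ : Matrix.unitaryGroup (Fin a₀ × B₀) ℂ) (U₁ : Matrix.unitaryGroup (Fin a₁ × B₁) ℂ),
      Compatible U₀.1 U₁.1 σ → IsProductUnitary U₀.1 ∧ IsProductUnitary U₁.1

end Catalysis

/-- A projective measurement `{Π₁, …, Πₙ}`: nonzero, mutually orthogonal projectors summing to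
the identity. -/
structure IsProjectiveMeasurement {X : Type*} [Fintype X] [DecidableEq X] {n : ℕ}
    (P : Fin n → Matrix X X ℂ) : Prop where
  isHermitian : ∀ i, (P i).IsHermitian
  mul_eq : ∀ i j, P i * P j = if i = j then P i else 0
  sum_eq : ∑ i, P i = 1
  ne_zero : ∀ i, P i ≠ 0

section PartiallyClassical

variable {B₀ B₁ : Type*} [Fintype B₀] [Fintype B₁] [DecidableEq B₀] [DecidableEq B₁]

/-- `σ` is PC-Q: some projective measurement on the first system with more than one outcome
leaves `σ` unperturbed. -/
def IsPCQ (σ : State (B₀ × B₁)) : Prop :=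
  ∃ (n : ℕ) (P : Fin n → Matrix B₀ B₀ ℂ), 1 < n ∧ IsProjectiveMeasurement P ∧
    σ.mat = ∑ i, (P i ⊗ₖ (1 : Matrix B₁ B₁ ℂ)) * σ.mat * (P i ⊗ₖ (1 : Matrix B₁ B₁ ℂ))

/-- `σ` is Q-PC: some projective measurement on the second system with more than one outcome
leaves `σ` unperturbed. -/
def IsQPC (σ : State (B₀ × B₁)) : Prop :=
  ∃ (n : ℕ) (P : Fin n → Matrix B₁ B₁ ℂ), 1 < n ∧ IsProjectiveMeasurement P ∧
    σ.mat = ∑ i, ((1 : Matrix B₀ B₀ ℂ) ⊗ₖ P i) * σ.mat * ((1 : Matrix B₀ B₀ ℂ) ⊗ₖ P i)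

/-- `σ` is TQ-TQ: neither PC-Q nor Q-PC. -/
def IsTQTQ (σ : State (B₀ × B₁)) : Prop :=
  ¬ IsPCQ σ ∧ ¬ IsQPC σ

/-- Both marginals of `σ` have full rank. -/
def LocallyFullRank (σ : State (B₀ × B₁)) : Prop :=
  (traceRight σ.mat).PosDef ∧ (traceLeft σ.mat).PosDef

/-- `τ` is `σ` regarded as a state on the supports `C₀`, `C₁` of the marginals of `σ`: `τ` has
full-rank marginals, and `σ` is the image of `τ` under isometric embeddings `V₀ : C₀ → B₀` and
`V₁ : C₁ → B₁` of the local spaces (whose ranges are then the supports of the marginals). -/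
def IsRestrictionToSupports {C₀ C₁ : Type*} [Fintype C₀] [Fintype C₁] [DecidableEq C₀]
    [DecidableEq C₁] (τ : State (C₀ × C₁)) (σ : State (B₀ × B₁)) : Prop :=
  LocallyFullRank τ ∧
    ∃ (V₀ : Matrix B₀ C₀ ℂ) (V₁ : Matrix B₁ C₁ ℂ),
      V₀.conjTranspose * V₀ = 1 ∧ V₁.conjTranspose * V₁ = 1 ∧
        σ.mat = (V₀ ⊗ₖ V₁) * τ.mat * (V₀ ⊗ₖ V₁).conjTranspose

end PartiallyClassical

end CatalyticRandomness

end

set_option linter.unusedSectionVars false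

namespace CatalyticRandomness

open Matrix

/-! ### Tensor products and partial traces -/

section Tensor

variable {A B X Y : Type*} [Fintype A] [Fintype B] [Fintype X] [Fintype Y]

/-! Compatibility is a commutation relation in disguise. Let `J` be the joint unitary and `S = 1 ⊗
σ`. For a maximally mixed target, returning `σ` fixes the overlap `Tr[J S J† S]` at `Tr[S²]`, its
value when `J S J† = S`. Hence the commutator of `J` and `S` has Hilbert–Schmidt norm zero
(`commute_one_kronecker_of_traceLeft_eq`), and `σ` commutes with every `K ⊗ L`, where `K`, `L` are
blocks of `U₀`, `U₁` on the source. Since `σ` is Hermitian, it also commutes with `K†K' ⊗ L†L`;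
summing over a block column of `U₁` turns `L†L` into the identity, so `K†K' ⊗ 1` commutes with `σ`
(`Compatible.commute_conjTranspose_mul`).

If `σ` is not PC-Q, such operators are scalar, because spectral projectors of a nonscalar Hermitian
one would give an undisturbing measurement. When all `K†K'` are scalar, the blocks are multiples of
a single unitary and `U₀` is a product (`isProductUnitary_of_block`). Product unitaries merely
conjugate the target unitarily, so entropy is unchanged.

Conversely, a nontrivial projector `P` with `P ⊗ 1` commuting with `σ` can control a bit flip
without disturbing `σ`. This unitary is not a product, and it sends a pure qubit to `diag(p, 1-p)`
with `p = Tr[(P ⊗ 1)σ]`. Full-rank marginals force `0 < p < 1`. In general, compatible unitaries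
preserve the supports of the marginals and may be compressed to them. -/

theorem kronecker_sum {ι : Type*} (s : Finset ι) (M : Matrix X X ℂ) (f : ι → Matrix Y Y ℂ) :
    M ⊗ₖ (∑ i ∈ s, f i) = ∑ i ∈ s, M ⊗ₖ f i := by
  ext; simp [Matrix.sum_apply, Finset.mul_sum]

theorem kronecker_submatrix_swap (M : Matrix X X ℂ) (N : Matrix Y Y ℂ) :
    (M ⊗ₖ N).submatrix Prod.swap Prod.swap = N ⊗ₖ M := by
  ext; simp [mul_comm]

theorem kronecker_one_left_injective [DecidableEq Y] [Nonempty Y] {M N : Matrix X X ℂ}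
    (h : M ⊗ₖ (1 : Matrix Y Y ℂ) = N ⊗ₖ (1 : Matrix Y Y ℂ)) : M = N := by
  ext i j
  obtain ⟨y⟩ := ‹Nonempty Y›
  simpa using congr_fun₂ h (i, y) (j, y)

theorem traceLeft_add (M N : Matrix (X × Y) (X × Y) ℂ) :
    traceLeft (M + N) = traceLeft M + traceLeft N := by
  ext; simp [traceLeft, Finset.sum_add_distrib]

theorem traceRight_add (M N : Matrix (X × Y) (X × Y) ℂ) :
    traceRight (M + N) = traceRight M + traceRight N := by
  ext; simp [traceRight, Finset.sum_add_distrib]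

theorem traceLeft_kronecker (M : Matrix X X ℂ) (N : Matrix Y Y ℂ) :
    traceLeft (M ⊗ₖ N) = M.trace • N := by
  ext; simp [traceLeft, Matrix.trace, Finset.sum_mul]

theorem traceRight_kronecker (M : Matrix X X ℂ) (N : Matrix Y Y ℂ) :
    traceRight (M ⊗ₖ N) = N.trace • M := by
  ext; simp [traceRight, Matrix.trace, Finset.sum_mul, mul_comm (M _ _)]

theorem traceLeft_mul_one_kronecker [DecidableEq X] (M : Matrix (X × Y) (X × Y) ℂ)
    (N : Matrix Y Y ℂ) :
    traceLeft (M * ((1 : Matrix X X ℂ) ⊗ₖ N)) = traceLeft M * N := by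
  ext y y'
  simp only [traceLeft, of_apply, mul_apply, Fintype.sum_prod_type, kronecker_apply, one_apply,
    ite_mul, one_mul, zero_mul, mul_ite, mul_zero, Finset.sum_mul]
  simp only [Finset.sum_comm (s := Finset.univ (α := Y)) (t := Finset.univ (α := X))]
  simp

theorem trace_mul_one_kronecker [DecidableEq X] (M : Matrix (X × Y) (X × Y) ℂ)
    (N : Matrix Y Y ℂ) :
    (M * ((1 : Matrix X X ℂ) ⊗ₖ N)).trace = (traceLeft M * N).trace := by
  rw [← traceLeft_mul_one_kronecker]
  simp [traceLeft, Matrix.trace, Fintype.sum_prod_type_right]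

theorem trace_kronecker_one_mul [DecidableEq Y] (N : Matrix X X ℂ)
    (M : Matrix (X × Y) (X × Y) ℂ) :
    ((N ⊗ₖ (1 : Matrix Y Y ℂ)) * M).trace = (N * traceRight M).trace := by
  simp only [traceRight, Matrix.trace, diag_apply, of_apply, mul_apply, Fintype.sum_prod_type,
    kronecker_apply, one_apply, ite_mul, mul_one, zero_mul, mul_ite, mul_zero, Finset.mul_sum]
  refine Finset.sum_congr rfl fun x _ => ?_
  rw [Finset.sum_comm]
  refine Finset.sum_congr rfl fun x' _ => ?_
  simp

/-- The block `⟨a| U |a'⟩`, an operator on the second tensor factor. -/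
def block (U : Matrix (A × B) (A × B) ℂ) (a a' : A) : Matrix B B ℂ :=
  U.submatrix (Prod.mk a) (Prod.mk a')

theorem block_kronecker (W : Matrix A A ℂ) (V : Matrix B B ℂ) (a a' : A) :
    block (W ⊗ₖ V) a a' = W a a' • V := by
  ext; simp [block]

theorem block_add (M N : Matrix (A × B) (A × B) ℂ) (a a' : A) :
    block (M + N) a a' = block M a a' + block N a a' := rfl

theorem ext_block {M N : Matrix (A × B) (A × B) ℂ} (h : ∀ a a', block M a a' = block N a a') :
    M = N := by
  ext ⟨a, b⟩ ⟨a', b'⟩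
  exact congr_fun₂ (h a a') b b'

variable [DecidableEq A] [DecidableEq B]

theorem block_mul (M N : Matrix (A × B) (A × B) ℂ) (a a' : A) :
    block (M * N) a a' = ∑ c, block M a c * block N c a' := by
  ext b b'
  simp [block, mul_apply, Matrix.sum_apply, Fintype.sum_prod_type]

theorem block_one (a : A) : block (1 : Matrix (A × B) (A × B) ℂ) a a = 1 := by
  ext; simp [block, one_apply]

theorem sum_block_conjTranspose_mul_block {U : Matrix (A × B) (A × B) ℂ} (hU : Uᴴ * U = 1)
    (a : A) : ∑ c, (block U c a)ᴴ * block U c a = 1 := by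
  rw [← block_one a, ← hU, block_mul]
  rfl

/-- Since `M ⊗ 1` acts slice by slice, commutation with it becomes commutation of `M` with a family
of matrices. Functional calculus can then be applied to `M` alone. -/
theorem kronecker_one_commute_iff {M : Matrix A A ℂ} {N : Matrix (A × B) (A × B) ℂ} :
    Commute (M ⊗ₖ (1 : Matrix B B ℂ)) N ↔
      ∀ b b', Commute M (N.submatrix (fun a => (a, b)) fun a => (a, b')) := by
  have h₁ : ∀ a b a' b', ((M ⊗ₖ (1 : Matrix B B ℂ)) * N) (a, b) (a', b') =
      (M * N.submatrix (fun a => (a, b)) fun a => (a, b')) a a' := by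
    intro a b a' b'
    simp [mul_apply, Fintype.sum_prod_type, one_apply]
  have h₂ : ∀ a b a' b', (N * (M ⊗ₖ (1 : Matrix B B ℂ))) (a, b) (a', b') =
      ((N.submatrix (fun a => (a, b)) fun a => (a, b')) * M) a a' := by
    intro a b a' b'
    simp [mul_apply, Fintype.sum_prod_type, one_apply]
  refine ⟨fun h b b' => ?_, fun h => ?_⟩
  · ext a a'
    rw [← h₁, ← h₂, h.eq]
  · ext ⟨a, b⟩ ⟨a', b'⟩
    rw [h₁, h₂, (h b b').eq]

end Tensor

/-! ### Operators commuting with a state -/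

section Symmetry

variable {B₀ B₁ : Type*} [Fintype B₀] [Fintype B₁] [DecidableEq B₀] [DecidableEq B₁]

theorem State.nonempty {X : Type*} [Fintype X] (σ : State X) : Nonempty X := by
  by_contra h
  rw [not_nonempty_iff] at h
  simpa [Matrix.trace] using σ.trace_eq_one

theorem State.star_mat {X : Type*} [Fintype X] (σ : State X) : star σ.mat = σ.mat :=
  σ.posSemidef.isHermitian

/-- A state is PC-Q exactly when a nontrivial projector on the first system commutes with it. -/
theorem isPCQ_iff {σ : State (B₀ × B₁)} :
    IsPCQ σ ↔ ∃ P : Matrix B₀ B₀ ℂ, P.IsHermitian ∧ P * P = P ∧ P ≠ 0 ∧ P ≠ 1 ∧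
      Commute (P ⊗ₖ (1 : Matrix B₁ B₁ ℂ)) σ.mat := by
  constructor
  · rintro ⟨n, P, hn, hP, hσ⟩
    let i : Fin n := ⟨0, by omega⟩
    let j : Fin n := ⟨1, hn⟩
    have hij : i ≠ j := by simp [i, j]
    refine ⟨P i, hP.isHermitian i, by simp [hP.mul_eq], hP.ne_zero i, fun h => ?_, ?_⟩
    · have := hP.mul_eq i j
      rw [h, one_mul, if_neg hij] at this
      exact hP.ne_zero j this
    · have hmul : ∀ k l, (P k ⊗ₖ (1 : Matrix B₁ B₁ ℂ)) * (P l ⊗ₖ (1 : Matrix B₁ B₁ ℂ)) =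
          if k = l then P k ⊗ₖ (1 : Matrix B₁ B₁ ℂ) else 0 := by
        intro k l
        rw [← mul_kronecker_mul, hP.mul_eq, mul_one]
        split_ifs <;> simp
      -- By orthogonality only the `i`-th term of `σ` survives multiplication by `P i` on either
      -- side, so both products equal the compressed operator.
      have hl : (P i ⊗ₖ (1 : Matrix B₁ B₁ ℂ)) * σ.mat =
          (P i ⊗ₖ (1 : Matrix B₁ B₁ ℂ)) * σ.mat * (P i ⊗ₖ (1 : Matrix B₁ B₁ ℂ)) := by
        conv_lhs => rw [hσ]
        simp [Finset.mul_sum, ← Matrix.mul_assoc, hmul, ite_mul]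
      have hr : σ.mat * (P i ⊗ₖ (1 : Matrix B₁ B₁ ℂ)) =
          (P i ⊗ₖ (1 : Matrix B₁ B₁ ℂ)) * σ.mat * (P i ⊗ₖ (1 : Matrix B₁ B₁ ℂ)) := by
        conv_lhs => rw [hσ]
        simp [Finset.sum_mul, Matrix.mul_assoc, hmul]
      exact hl.trans hr.symm
  · rintro ⟨P, hH, hP, h0, h1, hc⟩
    refine ⟨2, ![P, 1 - P], one_lt_two, ⟨?_, ?_, ?_, ?_⟩, ?_⟩
    · simp [Fin.forall_fin_two, hH, isHermitian_one.sub hH]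
    · simp [Fin.forall_fin_two, mul_sub, sub_mul, hP]
    · simp
    · simp [Fin.forall_fin_two, h0, sub_ne_zero, h1.symm]
    · have hsub : (1 - P) ⊗ₖ (1 : Matrix B₁ B₁ ℂ) = 1 - P ⊗ₖ (1 : Matrix B₁ B₁ ℂ) := by
        rw [eq_sub_iff_add_eq, ← add_kronecker, sub_add_cancel, one_kronecker_one]
      have hPP : (P ⊗ₖ (1 : Matrix B₁ B₁ ℂ)) * (P ⊗ₖ (1 : Matrix B₁ B₁ ℂ)) =
          P ⊗ₖ (1 : Matrix B₁ B₁ ℂ) := by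
        rw [← mul_kronecker_mul, hP, mul_one]
      simp only [Fin.sum_univ_two, cons_val_zero, cons_val_one, hsub]
      rw [hc.eq, ((Commute.one_left _).sub_left hc).eq, Matrix.mul_assoc, Matrix.mul_assoc, hPP,
        ← Matrix.mul_add]
      simp [sub_mul, mul_sub, hPP]

/-- The projector is the spectral projector of one eigenvalue. It is nonzero because the eigenvalue
occurs, is not the identity because `H` has another eigenvalue, and inherits the commutant of `H`
from the functional calculus. -/
theorem exists_projection_of_isHermitian {X : Type*} [Fintype X] [DecidableEq X] [Nonempty X]
    {H : Matrix X X ℂ} (hH : H.IsHermitian) (hs : ∀ c : ℂ, H ≠ c • 1) :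
    ∃ P : Matrix X X ℂ, P.IsHermitian ∧ P * P = P ∧ P ≠ 0 ∧ P ≠ 1 ∧
      ∀ M, Commute H M → Commute P M := by
  have hsa : IsSelfAdjoint H := hH
  have hfin : (spectrum ℝ H).Finite := Matrix.finite_real_spectrum
  have hcont : ∀ f : ℝ → ℝ, ContinuousOn f (spectrum ℝ H) := fun f => hfin.continuousOn f
  let l : ℝ := hH.eigenvalues (Classical.arbitrary X)
  have hl : l ∈ spectrum ℝ H := hH.eigenvalues_mem_spectrum_real _
  -- An indicator function is admissible here because every function is continuous on the finite
  -- spectrum.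
  let f : ℝ → ℝ := fun t => if t = l then 1 else 0
  refine ⟨cfc f H, cfc_predicate f H, ?_, fun h => ?_, fun h => ?_, fun M hM => ?_⟩
  · rw [← cfc_mul f f H (hcont _) (hcont _)]
    congr 1
    ext t
    simp [f]
  · have h' : cfc f H = cfc (fun _ => (0 : ℝ)) H := by rw [h, cfc_const_zero ℝ H]
    have := (cfc_eq_cfc_iff_eqOn (hf := hcont _) (hg := hcont _)).1 h' hl
    simp [f] at this
  · have h' : cfc f H = cfc (fun _ => (1 : ℝ)) H := by rw [h, cfc_const_one ℝ H]
    have heq := (cfc_eq_cfc_iff_eqOn (hf := hcont _) (hg := hcont _)).1 h'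
    apply hs l
    have : H = cfc (fun _ => l) H := by
      conv_lhs => rw [← cfc_id ℝ H]
      refine cfc_congr fun t ht => ?_
      have := heq ht
      simpa [f] using this
    rw [this, cfc_const l H, Algebra.algebraMap_eq_smul_one]
    ext; simp
  · exact Commute.cfc_real hM f

theorem commute_kronecker_one_conjTranspose {σ : State (B₀ × B₁)} {X : Matrix B₀ B₀ ℂ}
    (h : Commute (X ⊗ₖ (1 : Matrix B₁ B₁ ℂ)) σ.mat) :
    Commute (Xᴴ ⊗ₖ (1 : Matrix B₁ B₁ ℂ)) σ.mat := by
  have := h.star_star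
  rwa [σ.star_mat, star_eq_conjTranspose, conjTranspose_kronecker, conjTranspose_one] at this

/-- If `σ` is not PC-Q, only scalars on the first system commute with it. -/
theorem eq_smul_one_of_not_isPCQ {σ : State (B₀ × B₁)} (hσ : ¬ IsPCQ σ) {X : Matrix B₀ B₀ ℂ}
    (hX : Commute (X ⊗ₖ (1 : Matrix B₁ B₁ ℂ)) σ.mat) : ∃ c : ℂ, X = c • 1 := by
  have : Nonempty B₀ := σ.nonempty.map Prod.fst
  have key : ∀ H : Matrix B₀ B₀ ℂ, H.IsHermitian →
      Commute (H ⊗ₖ (1 : Matrix B₁ B₁ ℂ)) σ.mat → ∃ c : ℂ, H = c • 1 := by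
    intro H hH hc
    by_contra! hs
    obtain ⟨P, h1, h2, h3, h4, h5⟩ := exists_projection_of_isHermitian hH hs
    exact hσ (isPCQ_iff.2 ⟨P, h1, h2, h3, h4, kronecker_one_commute_iff.2 fun b b' =>
      h5 _ (kronecker_one_commute_iff.1 hc b b')⟩)
  -- The commutant of a Hermitian operator is closed under adjoints, so the Hermitian case applies
  -- to `X + X†` and `i(X - X†)`. Their scalars `c`, `d` give `X = (c - i d)/2`.
  have hX' := commute_kronecker_one_conjTranspose hX
  obtain ⟨c, hc⟩ := key (X + Xᴴ) (isHermitian_add_transpose_self X) (by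
    rw [add_kronecker]; exact hX.add_left hX')
  obtain ⟨d, hd⟩ := key (Complex.I • (X - Xᴴ)) (by
      rw [Matrix.IsHermitian, conjTranspose_smul, conjTranspose_sub, conjTranspose_conjTranspose,
        RCLike.star_def, Complex.conj_I, neg_smul, ← smul_neg, neg_sub]) (by
    rw [smul_kronecker, sub_eq_add_neg, add_kronecker, ← neg_one_smul ℂ Xᴴ, smul_kronecker]
    exact (hX.add_left (hX'.smul_left _)).smul_left _)
  refine ⟨(c - Complex.I * d) / 2, ?_⟩
  have h2 : X - Xᴴ = (-Complex.I * d) • 1 := by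
    rw [mul_smul, ← hd, smul_smul]
    simp
  have : (2 : ℂ) • X = (c - Complex.I * d) • 1 := by
    rw [two_smul, sub_eq_add_neg, add_smul, ← hc, ← neg_mul, ← h2]
    abel
  rw [div_eq_inv_mul, mul_smul, ← this, smul_smul]
  simp

end Symmetry

/-! ### Compatible interactions commute with the source -/

section Commutation

variable {A B : Type*} [Fintype A] [Fintype B] [DecidableEq A] [DecidableEq B]

/-- A unitary that preserves a Hermitian operator `s` while the other tensor factor is maximally
mixed commutes with `1 ⊗ s`. -/
theorem commute_one_kronecker_of_traceLeft_eq {U : Matrix (A × B) (A × B) ℂ} {s : Matrix B B ℂ}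
    (hU : Uᴴ * U = 1) (hs : s.IsHermitian)
    (h : traceLeft (U * ((1 : Matrix A A ℂ) ⊗ₖ s) * Uᴴ) = (Fintype.card A : ℂ) • s) :
    Commute U ((1 : Matrix A A ℂ) ⊗ₖ s) := by
  set S := (1 : Matrix A A ℂ) ⊗ₖ s with hS
  have hU' : U * Uᴴ = 1 := mul_eq_one_comm.1 hU
  have hSH : Sᴴ = S := by rw [hS, conjTranspose_kronecker, conjTranspose_one, hs.eq]
  have hSS : (S * S).trace = Fintype.card A * (s * s).trace := by
    rw [hS, ← mul_kronecker_mul, trace_kronecker, one_mul, trace_one]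
  -- The only use of the preservation hypothesis: tracing out `A` first reduces the cross term to
  -- `Tr[s²]` times the dimension.
  have hcross : (U * S * Uᴴ * S).trace = Fintype.card A * (s * s).trace := by
    rw [hS, trace_mul_one_kronecker, ← hS, h, smul_mul, trace_smul, smul_eq_mul]
  have hD : (U * S - S * U) * (U * S - S * U)ᴴ =
      U * (S * S * Uᴴ) - U * S * Uᴴ * S - S * (U * S * Uᴴ) + S * (U * Uᴴ) * S := by
    rw [conjTranspose_sub, conjTranspose_mul, conjTranspose_mul, hSH]
    noncomm_ring
  have h0 : ((U * S - S * U) * (U * S - S * U)ᴴ).trace = 0 := by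
    rw [hD, trace_add, trace_sub, trace_sub, trace_mul_comm S (U * S * Uᴴ), hcross, hU', mul_one,
      hSS, trace_mul_comm U, Matrix.mul_assoc, hU, mul_one, hSS]
    ring
  exact sub_eq_zero.1 (trace_mul_conjTranspose_self_eq_zero_iff.1 h0)

theorem commute_block {U : Matrix (A × B) (A × B) ℂ} {s : Matrix B B ℂ}
    (h : Commute U ((1 : Matrix A A ℂ) ⊗ₖ s)) (a a' : A) : Commute (block U a a') s := by
  have := congr_arg (block · a a') h.eq
  simpa [block_mul, block_kronecker, one_apply, Commute, SemiconjBy] using this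

/-- The maximally mixed state. -/
noncomputable def maximallyMixed (X : Type*) [Fintype X] [DecidableEq X] [Nonempty X] : State X where
  mat := ((Fintype.card X : ℂ)⁻¹) • 1
  posSemidef := PosSemidef.one.smul (by positivity)
  trace_eq_one := by simp [trace_smul]

variable {A₀ A₁ B₀ B₁ : Type*} [Fintype A₀] [Fintype A₁] [Fintype B₀] [Fintype B₁]
  [DecidableEq A₀] [DecidableEq A₁] [DecidableEq B₀] [DecidableEq B₁]

theorem jointOp_kronecker (W₀ : Matrix A₀ A₀ ℂ) (V₀ : Matrix B₀ B₀ ℂ) (W₁ : Matrix A₁ A₁ ℂ)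
    (V₁ : Matrix B₁ B₁ ℂ) :
    jointOp (W₀ ⊗ₖ V₀) (W₁ ⊗ₖ V₁) = (W₀ ⊗ₖ W₁) ⊗ₖ (V₀ ⊗ₖ V₁) := by
  ext ⟨⟨_, _⟩, _, _⟩ ⟨⟨_, _⟩, _, _⟩
  simp [jointOp, mul_mul_mul_comm]

variable [Nonempty A₀] [Nonempty A₁] {U₀ : unitaryGroup (A₀ × B₀) ℂ}
  {U₁ : unitaryGroup (A₁ × B₁) ℂ} {σ : State (B₀ × B₁)}

/-- Of all inputs, only the maximally mixed one is needed. -/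
theorem Compatible.commute (h : Compatible U₀.1 U₁.1 σ) :
    Commute (jointOp U₀.1 U₁.1) ((1 : Matrix (A₀ × A₁) (A₀ × A₁) ℂ) ⊗ₖ σ.mat) := by
  refine commute_one_kronecker_of_traceLeft_eq (jointOp_mem U₀.2 U₁.2) σ.posSemidef.isHermitian ?_
  have h' := h (maximallyMixed (A₀ × A₁))
  have hc : (Fintype.card (A₀ × A₁) : ℂ) ≠ 0 := by simp
  rw [← inv_smul_eq_iff₀ hc]
  refine Eq.trans ?_ h'
  ext
  simp [evolve, maximallyMixed, smul_kronecker, traceLeft, Finset.mul_sum]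

theorem Compatible.commute_block (h : Compatible U₀.1 U₁.1 σ) (a b : A₀) (c d : A₁) :
    Commute (block U₀.1 a b ⊗ₖ block U₁.1 c d) σ.mat :=
  CatalyticRandomness.commute_block h.commute (a, c) (b, d)

theorem unitary_conjTranspose_mul {X : Type*} [Fintype X] [DecidableEq X] (U : unitaryGroup X ℂ) :
    U.1ᴴ * U.1 = 1 := mem_unitaryGroup_iff'.1 U.2

/-- The blocks in one column of `U₁` satisfy `∑ L†L = 1`, which removes the second party from the
relation `K ⊗ L` satisfies. -/
theorem Compatible.commute_conjTranspose_mul (h : Compatible U₀.1 U₁.1 σ) (a b a' b' : A₀) :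
    Commute (((block U₀.1 a b)ᴴ * block U₀.1 a' b') ⊗ₖ (1 : Matrix B₁ B₁ ℂ)) σ.mat := by
  obtain ⟨d⟩ := ‹Nonempty A₁›
  rw [← sum_block_conjTranspose_mul_block (unitary_conjTranspose_mul U₁) d, kronecker_sum]
  refine Commute.sum_left _ _ _ fun c _ => ?_
  have h' := (h.commute_block a b c d).star_star
  rw [σ.star_mat, star_eq_conjTranspose, conjTranspose_kronecker] at h'
  rw [mul_kronecker_mul]
  exact h'.mul_left (h.commute_block a' b' c d)

/-- If all products `K†K'` of blocks of a unitary are scalar, the unitary is a product. -/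
theorem isProductUnitary_of_block [Nonempty B₀]
    (h : ∀ a b a' b', ∃ c : ℂ, (block U₀.1 a b)ᴴ * block U₀.1 a' b' = c • 1) :
    IsProductUnitary U₀.1 := by
  obtain ⟨b⟩ := ‹Nonempty A₀›
  obtain ⟨y⟩ := ‹Nonempty B₀›
  have hU := unitary_conjTranspose_mul U₀
  obtain ⟨a, ha⟩ : ∃ a, block U₀.1 a b ≠ 0 := by
    by_contra! h0
    have := sum_block_conjTranspose_mul_block hU b
    simp only [h0, mul_zero, Finset.sum_const_zero] at this
    simpa using congr_fun₂ this y y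
  choose g hg using fun a' b' => h a b a' b'
  -- With `K†K = c` and `c > 0`, the rescaled `V = K/√c` is unitary. Any other block is then `V`
  -- times the scalar matrix formed by `V†` and that block.
  obtain ⟨c, hc⟩ := h a b a b
  generalize block U₀.1 a b = K at ha hg hc
  have hc0 : 0 ≤ c := by
    have := (posSemidef_conjTranspose_mul_self K).diag_nonneg (i := y)
    rw [hc] at this
    simpa using this
  have hcne : c ≠ 0 := by
    rintro rfl
    rw [zero_smul, conjTranspose_mul_self_eq_zero] at hc
    exact ha hc
  obtain ⟨r, hr, rfl⟩ : ∃ r : ℝ, 0 ≤ r ∧ (r : ℂ) = c :=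
    ⟨c.re, (Complex.le_def.1 hc0).1, by
      apply Complex.ext <;> simp [← (Complex.le_def.1 hc0).2]⟩
  let V : Matrix B₀ B₀ ℂ := ((Real.sqrt r : ℝ) : ℂ)⁻¹ • K
  have hV : Vᴴ * V = 1 := by
    have : ((Real.sqrt r : ℝ) : ℂ) * ((Real.sqrt r : ℝ) : ℂ) = r := by
      rw [← Complex.ofReal_mul, Real.mul_self_sqrt hr]
    simp only [V, conjTranspose_smul, smul_mul, Matrix.mul_smul, star_inv₀, RCLike.star_def,
      Complex.conj_ofReal, hc, smul_smul]
    rw [← mul_assoc, ← mul_inv, this, inv_mul_cancel₀ hcne, one_smul]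
  have hV' : V * Vᴴ = 1 := mul_eq_one_comm.1 hV
  let W : Matrix A₀ A₀ ℂ := of fun a' b' => ((Real.sqrt r : ℝ) : ℂ)⁻¹ * g a' b'
  have hUWV : U₀.1 = W ⊗ₖ V := by
    refine ext_block fun a' b' => ?_
    rw [block_kronecker, ← one_mul (block U₀.1 a' b'), ← hV', Matrix.mul_assoc]
    have : Vᴴ * block U₀.1 a' b' = W a' b' • 1 := by
      simp only [V, conjTranspose_smul, smul_mul, hg, smul_smul, star_inv₀, RCLike.star_def,
        Complex.conj_ofReal, W, of_apply]
    rw [this, Matrix.mul_smul, mul_one]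
  refine ⟨W, mem_unitaryGroup_iff'.2 ?_, V, mem_unitaryGroup_iff'.2 hV, hUWV⟩
  rw [hUWV, conjTranspose_kronecker, ← mul_kronecker_mul, hV, ← one_kronecker_one] at hU
  have : Nonempty B₀ := ⟨y⟩
  exact kronecker_one_left_injective hU

theorem Compatible.isProductUnitary_left (h : Compatible U₀.1 U₁.1 σ) (hσ : ¬ IsPCQ σ) :
    IsProductUnitary U₀.1 := by
  have : Nonempty B₀ := σ.nonempty.map Prod.fst
  exact isProductUnitary_of_block fun a b a' b' =>
    eq_smul_one_of_not_isPCQ hσ (h.commute_conjTranspose_mul a b a' b')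

end Commutation

/-! ### Exchanging the two parties -/

section Swap

variable {X Y : Type*} [Fintype X] [Fintype Y]

/-- The state with the two subsystems exchanged. -/
def State.swap (σ : State (X × Y)) : State (Y × X) where
  mat := σ.mat.submatrix Prod.swap Prod.swap
  posSemidef := σ.posSemidef.submatrix _
  trace_eq_one := by
    rw [← σ.trace_eq_one, Matrix.trace, Matrix.trace]
    exact (Equiv.prodComm Y X).sum_comp fun i => σ.mat i i

theorem State.swap_swap (σ : State (X × Y)) : σ.swap.swap = σ := rfl

theorem traceRight_swap (σ : State (X × Y)) : traceRight σ.swap.mat = traceLeft σ.mat := rfl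

variable [DecidableEq X] [DecidableEq Y]

/-- Together with the swap rules for compatibility and output, this reduces every claim about the
second party to the first. -/
theorem isQPC_iff_swap {σ : State (X × Y)} : IsQPC σ ↔ IsPCQ σ.swap := by
  refine exists_congr fun n => exists_congr fun P => and_congr_right fun _ =>
    and_congr_right fun _ => ?_
  have h : ∀ i, (P i ⊗ₖ (1 : Matrix X X ℂ)) * σ.swap.mat * (P i ⊗ₖ (1 : Matrix X X ℂ)) =
      (((1 : Matrix X X ℂ) ⊗ₖ P i) * σ.mat * ((1 : Matrix X X ℂ) ⊗ₖ P i)).submatrix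
        (Equiv.prodComm Y X) (Equiv.prodComm Y X) := by
    intro i
    rw [← submatrix_mul_equiv _ _ _ (Equiv.prodComm Y X), ← submatrix_mul_equiv _ _ _
      (Equiv.prodComm Y X), ← kronecker_submatrix_swap]
    rfl
  simp_rw [h]
  refine ⟨fun hσ => ?_, fun hσ => ?_⟩
  · ext i j
    have := congr_fun₂ hσ i.swap j.swap
    simpa [Matrix.sum_apply, State.swap] using this
  · ext i j
    have := congr_fun₂ hσ i.swap j.swap
    simpa [Matrix.sum_apply, State.swap] using this

variable {A₀ A₁ B₀ B₁ : Type*} [Fintype A₀] [Fintype A₁] [Fintype B₀] [Fintype B₁]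
  [DecidableEq A₀] [DecidableEq A₁] [DecidableEq B₀] [DecidableEq B₁]

theorem evolve_swap (U₀ : Matrix (A₀ × B₀) (A₀ × B₀) ℂ) (U₁ : Matrix (A₁ × B₁) (A₁ × B₁) ℂ)
    (ρ : State (A₀ × A₁)) (σ : State (B₀ × B₁)) :
    evolve U₁ U₀ ρ.swap σ.swap = (evolve U₀ U₁ ρ σ).submatrix
      (Equiv.prodCongr (Equiv.prodComm A₁ A₀) (Equiv.prodComm B₁ B₀))
      (Equiv.prodCongr (Equiv.prodComm A₁ A₀) (Equiv.prodComm B₁ B₀)) := by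
  have hJ : jointOp U₁ U₀ = (jointOp U₀ U₁).submatrix
      (Equiv.prodCongr (Equiv.prodComm A₁ A₀) (Equiv.prodComm B₁ B₀))
      (Equiv.prodCongr (Equiv.prodComm A₁ A₀) (Equiv.prodComm B₁ B₀)) := by
    ext ⟨⟨_, _⟩, _, _⟩ ⟨⟨_, _⟩, _, _⟩
    simp [jointOp, mul_comm]
  rw [evolve, evolve, ← submatrix_mul_equiv _ _ _
    (Equiv.prodCongr (Equiv.prodComm A₁ A₀) (Equiv.prodComm B₁ B₀)), ← submatrix_mul_equiv _ _ _
    (Equiv.prodCongr (Equiv.prodComm A₁ A₀) (Equiv.prodComm B₁ B₀)), hJ,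
    conjTranspose_submatrix]
  rfl

theorem Compatible.swap {U₀ : Matrix (A₀ × B₀) (A₀ × B₀) ℂ} {U₁ : Matrix (A₁ × B₁) (A₁ × B₁) ℂ}
    {σ : State (B₀ × B₁)} (h : Compatible U₀ U₁ σ) : Compatible U₁ U₀ σ.swap := by
  intro ρ
  rw [← ρ.swap_swap, evolve_swap]
  ext i j
  refine Eq.trans ?_ (congr_fun₂ (h ρ.swap) i.swap j.swap)
  exact (Equiv.prodComm A₁ A₀).sum_comp
    fun x => evolve U₀ U₁ ρ.swap σ (x, i.swap) (x, j.swap)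

theorem output_swap (U₀ : unitaryGroup (A₀ × B₀) ℂ) (U₁ : unitaryGroup (A₁ × B₁) ℂ)
    (ρ : State (A₀ × A₁)) (σ : State (B₀ × B₁)) :
    (output U₁ U₀ ρ.swap σ.swap).mat = (output U₀ U₁ ρ σ).swap.mat := by
  ext i j
  simp only [output, evolve_swap]
  exact (Equiv.prodComm B₁ B₀).sum_comp
    fun x => evolve U₀.1 U₁.1 ρ σ (i.swap, x) (j.swap, x)

theorem Compatible.isProductUnitary_right [Nonempty A₀] [Nonempty A₁]
    {U₀ : unitaryGroup (A₀ × B₀) ℂ} {U₁ : unitaryGroup (A₁ × B₁) ℂ} {σ : State (B₀ × B₁)}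
    (h : Compatible U₀.1 U₁.1 σ) (hσ : ¬ IsQPC σ) : IsProductUnitary U₁.1 :=
  h.swap.isProductUnitary_left fun h' => hσ (isQPC_iff_swap.2 h')

theorem onlyProductCompatible_of_isTQTQ {σ : State (B₀ × B₁)} (hσ : IsTQTQ σ) :
    OnlyProductCompatible σ := by
  intro a₀ a₁ h₀ h₁ U₀ U₁ h
  have : Nonempty (Fin a₀) := ⟨⟨0, h₀⟩⟩
  have : Nonempty (Fin a₁) := ⟨⟨0, h₁⟩⟩
  exact ⟨h.isProductUnitary_left hσ.1, h.isProductUnitary_right hσ.2⟩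

end Swap

/-! ### Entropies -/

section Entropy

variable {X Y : Type*} [Fintype X] [DecidableEq X] [Fintype Y] [DecidableEq Y]

/-- The entropy only depends on the roots of the characteristic polynomial. -/
theorem State.renyiEntropy_eq_roots (α : ℝ) (ρ : State X) :
    ρ.renyiEntropy α = if α = 1 then
        (ρ.mat.charpoly.roots.map fun z => -(z.re * Real.logb 2 z.re)).sum
      else 1 / (1 - α) * Real.logb 2
        (ρ.mat.charpoly.roots.map fun z => if z.re ≠ 0 then z.re ^ α else 0).sum := by
  rw [State.renyiEntropy, ρ.posSemidef.isHermitian.roots_charpoly_eq_eigenvalues,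
    Multiset.map_map, Multiset.map_map, Finset.sum_filter]
  rfl

/-- Characteristic polynomials treat unitary conjugation and relabelling of the basis alike, with no
need to match orderings of eigenvalues. -/
theorem State.renyiEntropy_congr (α : ℝ) {ρ : State X} {ρ' : State Y}
    (h : ρ.mat.charpoly = ρ'.mat.charpoly) : ρ.renyiEntropy α = ρ'.renyiEntropy α := by
  rw [State.renyiEntropy_eq_roots, State.renyiEntropy_eq_roots, h]

theorem State.renyiEntropy_diagonal (α : ℝ) {ρ : State X} {d : X → ℝ}
    (h : ρ.mat = diagonal fun i => (d i : ℂ)) :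
    ρ.renyiEntropy α = if α = 1 then ∑ i, -(d i * Real.logb 2 (d i))
      else 1 / (1 - α) * Real.logb 2 (∑ i, if d i ≠ 0 then d i ^ α else 0) := by
  have hr : ρ.mat.charpoly.roots = Finset.univ.val.map fun i => (d i : ℂ) := by
    rw [h, charpoly_diagonal, Polynomial.roots_prod]
    · simp
    · simp [Finset.prod_ne_zero_iff, Polynomial.X_sub_C_ne_zero]
  rw [State.renyiEntropy_eq_roots, hr, Multiset.map_map, Multiset.map_map]
  rfl

theorem State.renyiEntropy_swap (α : ℝ) (ρ : State (X × Y)) :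
    ρ.swap.renyiEntropy α = ρ.renyiEntropy α :=
  State.renyiEntropy_congr α (charpoly_reindex (Equiv.prodComm X Y) ρ.mat)

/-- Away from `α = 1`, compare `p ^ α` with `p`: the sum of powers exceeds 1 for `α < 1` and falls
below 1 for `α > 1`, matching the sign of `1 - α`. -/
theorem binary_entropy_pos (α : ℝ) {p : ℝ} (h0 : 0 < p) (h1 : p < 1) :
    0 < if α = 1 then -((1 - p) * Real.logb 2 (1 - p)) + -(p * Real.logb 2 p)
      else 1 / (1 - α) * Real.logb 2 (p ^ α + (1 - p) ^ α) := by
  have h0' : 0 < 1 - p := by linarith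
  have h1' : 1 - p < 1 := by linarith
  split_ifs with hα
  · have h2 := mul_neg_of_pos_of_neg h0 (Real.logb_neg one_lt_two h0 h1)
    have h3 := mul_neg_of_pos_of_neg h0' (Real.logb_neg one_lt_two h0' h1')
    linarith
  · rcases lt_or_gt_of_ne hα with hα | hα
    · have h2 := Real.rpow_lt_rpow_of_exponent_gt h0 h1 hα
      have h3 := Real.rpow_lt_rpow_of_exponent_gt h0' h1' hα
      rw [Real.rpow_one] at h2 h3
      have : 0 < 1 - α := by linarith
      exact mul_pos (by positivity) (Real.logb_pos one_lt_two (by linarith))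
    · have h2 := Real.rpow_lt_rpow_of_exponent_gt h0 h1 hα
      have h3 := Real.rpow_lt_rpow_of_exponent_gt h0' h1' hα
      rw [Real.rpow_one] at h2 h3
      exact mul_pos_of_neg_of_neg (one_div_neg.2 (by linarith))
        (Real.logb_neg one_lt_two (by positivity) (by linarith))

end Entropy

/-! ### Product interactions do not change the entropy -/

section Product

variable {A₀ A₁ B₀ B₁ : Type*} [Fintype A₀] [Fintype A₁] [Fintype B₀] [Fintype B₁]
  [DecidableEq A₀] [DecidableEq A₁] [DecidableEq B₀] [DecidableEq B₁]

theorem renyiEntropy_output_of_isProductUnitary (α : ℝ) {U₀ : unitaryGroup (A₀ × B₀) ℂ}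
    {U₁ : unitaryGroup (A₁ × B₁) ℂ} (h₀ : IsProductUnitary U₀.1) (h₁ : IsProductUnitary U₁.1)
    (ρ : State (A₀ × A₁)) (σ : State (B₀ × B₁)) :
    (output U₀ U₁ ρ σ).renyiEntropy α = ρ.renyiEntropy α := by
  obtain ⟨W₀, hW₀, V₀, hV₀, h₀⟩ := h₀
  obtain ⟨W₁, hW₁, V₁, hV₁, h₁⟩ := h₁
  have hW : (W₀ ⊗ₖ W₁)ᴴ * (W₀ ⊗ₖ W₁) = 1 :=
    mem_unitaryGroup_iff'.1 (kronecker_mem_unitary hW₀ hW₁)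
  have hV : (V₀ ⊗ₖ V₁)ᴴ * (V₀ ⊗ₖ V₁) = 1 :=
    mem_unitaryGroup_iff'.1 (kronecker_mem_unitary hV₀ hV₁)
  have hout : (output U₀ U₁ ρ σ).mat = (W₀ ⊗ₖ W₁) * ρ.mat * (W₀ ⊗ₖ W₁)ᴴ := by
    simp only [output, evolve]
    rw [h₀, h₁, jointOp_kronecker, conjTranspose_kronecker, ← mul_kronecker_mul,
      ← mul_kronecker_mul, traceRight_kronecker, trace_mul_comm, ← Matrix.mul_assoc, hV, one_mul,
      σ.trace_eq_one, one_smul]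
  refine State.renyiEntropy_congr α ?_
  rw [hout, charpoly_mul_comm, ← Matrix.mul_assoc, hW, one_mul]

theorem not_randomnessExtractable_of_isTQTQ (α : ℝ) {σ : State (B₀ × B₁)} (hσ : IsTQTQ σ) :
    ¬ RandomnessExtractable α σ := by
  rintro ⟨a₀, a₁, h₀, h₁, U₀, U₁, hU, ρ, hρ⟩
  obtain ⟨p₀, p₁⟩ := onlyProductCompatible_of_isTQTQ hσ a₀ a₁ h₀ h₁ U₀ U₁ hU
  rw [renyiEntropy_output_of_isProductUnitary α p₀ p₁] at hρ
  exact lt_irrefl _ hρ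

theorem RandomnessExtractable.swap {α : ℝ} {σ : State (B₀ × B₁)}
    (h : RandomnessExtractable α σ) : RandomnessExtractable α σ.swap := by
  obtain ⟨a₀, a₁, h₀, h₁, U₀, U₁, hU, ρ, hρ⟩ := h
  refine ⟨a₁, a₀, h₁, h₀, U₁, U₀, hU.swap, ρ.swap, ?_⟩
  rw [State.renyiEntropy_swap, State.renyiEntropy_congr α
    (congr_arg Matrix.charpoly (output_swap U₀ U₁ ρ σ)), State.renyiEntropy_swap]
  exact hρ

end Product

/-! ### Controlled unitaries -/

section Controlled

variable {A B : Type*} [Fintype A] [Fintype B] [DecidableEq A] [DecidableEq B]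

/-- Apply `W` to the first factor unless the second one is in the range of the projector `Q`. -/
def controlled (W : Matrix A A ℂ) (Q : Matrix B B ℂ) : Matrix (A × B) (A × B) ℂ :=
  (1 : Matrix A A ℂ) ⊗ₖ Q + W ⊗ₖ (1 - Q)

/-- The cross terms carry `Q s (1 - Q)` or its mirror image, which vanish because `Q` commutes with
`s`. -/
theorem controlled_mul_mul_conjTranspose {Q : Matrix B B ℂ} (hQ : Q.IsHermitian)
    (hQQ : Q * Q = Q) {s : Matrix B B ℂ} (hs : Commute Q s) (W M : Matrix A A ℂ) :
    controlled W Q * (M ⊗ₖ s) * (controlled W Q)ᴴ =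
      M ⊗ₖ (Q * s) + (W * M * Wᴴ) ⊗ₖ ((1 - Q) * s) := by
  have h1 : Q * s * Q = Q * s := by rw [hs.eq, Matrix.mul_assoc, hQQ]
  have h2 : Q * s * (1 - Q) = 0 := by rw [mul_sub, h1, mul_one, sub_self]
  have h3 : (1 - Q) * s * Q = 0 := by
    rw [Matrix.mul_assoc, ← hs.eq, ← Matrix.mul_assoc, sub_mul, hQQ, one_mul, sub_self, zero_mul]
  have h4 : (1 - Q) * s * (1 - Q) = (1 - Q) * s := by rw [mul_sub, h3, mul_one, sub_zero]
  have hQ' : (1 - Q)ᴴ = 1 - Q := (isHermitian_one.sub hQ).eq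
  simp only [controlled, conjTranspose_add, conjTranspose_kronecker, conjTranspose_one, hQ.eq, hQ',
    add_mul, mul_add, ← mul_kronecker_mul, h1, h2, h3, h4, kronecker_zero, one_mul, mul_one,
    add_zero, zero_add]

theorem controlled_mem_unitaryGroup {Q : Matrix B B ℂ} (hQ : Q.IsHermitian)
    (hQQ : Q * Q = Q) {W : Matrix A A ℂ} (hW : W ∈ unitaryGroup A ℂ) :
    controlled W Q ∈ unitaryGroup (A × B) ℂ := by
  rw [mem_unitaryGroup_iff, star_eq_conjTranspose]
  -- Unitarity is the case `s = 1`, `M = 1` of the conjugation formula.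
  have h := controlled_mul_mul_conjTranspose hQ hQQ (Commute.one_right Q) W 1
  rw [one_kronecker_one, mul_one, mul_one, mul_one, mul_one, ← star_eq_conjTranspose W,
    mem_unitaryGroup_iff.1 hW, ← kronecker_add, add_sub_cancel, one_kronecker_one] at h
  exact h

theorem jointOp_controlled {A₀ A₁ B₀ B₁ : Type*} [Fintype A₀] [Fintype A₁] [Fintype B₀]
    [Fintype B₁] [DecidableEq A₀] [DecidableEq A₁] [DecidableEq B₀] [DecidableEq B₁]
    (W : Matrix A₀ A₀ ℂ) (Q : Matrix B₀ B₀ ℂ) :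
    jointOp (controlled W Q) (1 : Matrix (A₁ × B₁) (A₁ × B₁) ℂ) =
      controlled (W ⊗ₖ (1 : Matrix A₁ A₁ ℂ)) (Q ⊗ₖ (1 : Matrix B₁ B₁ ℂ)) := by
  have hsub : 1 - Q ⊗ₖ (1 : Matrix B₁ B₁ ℂ) = (1 - Q) ⊗ₖ (1 : Matrix B₁ B₁ ℂ) := by
    rw [sub_eq_iff_eq_add, ← add_kronecker, sub_add_cancel, one_kronecker_one]
  rw [controlled, controlled, hsub, ← one_kronecker_one (m := A₀) (n := A₁), ← jointOp_kronecker,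
    ← jointOp_kronecker, one_kronecker_one, jointOp, jointOp, jointOp, add_kronecker]
  rfl

variable {B₀ B₁ : Type*} [Fintype B₀] [Fintype B₁] [DecidableEq B₀] [DecidableEq B₁]
  {σ : State (B₀ × B₁)} {P : Matrix B₀ B₀ ℂ}

theorem evolve_controlled {A₀ A₁ : Type*} [Fintype A₀] [Fintype A₁] [DecidableEq A₀]
    [DecidableEq A₁] (hP : P.IsHermitian) (hPP : P * P = P)
    (hc : Commute (P ⊗ₖ (1 : Matrix B₁ B₁ ℂ)) σ.mat) (W : Matrix A₀ A₀ ℂ)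
    (ρ : State (A₀ × A₁)) :
    evolve (controlled W P) 1 ρ σ = ρ.mat ⊗ₖ ((P ⊗ₖ (1 : Matrix B₁ B₁ ℂ)) * σ.mat) +
      ((W ⊗ₖ (1 : Matrix A₁ A₁ ℂ)) * ρ.mat * (W ⊗ₖ (1 : Matrix A₁ A₁ ℂ))ᴴ) ⊗ₖ
        ((1 - P ⊗ₖ (1 : Matrix B₁ B₁ ℂ)) * σ.mat) := by
  rw [evolve, jointOp_controlled]
  refine controlled_mul_mul_conjTranspose ?_ ?_ hc _ _
  · rw [IsHermitian, conjTranspose_kronecker, hP.eq, conjTranspose_one]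
  · rw [← mul_kronecker_mul, hPP, mul_one]

/-- Both branches leave the target with unit trace, so discarding it recombines `Pσ + (1 - P)σ = σ`.
-/
theorem compatible_controlled {A₀ A₁ : Type*} [Fintype A₀] [Fintype A₁] [DecidableEq A₀]
    [DecidableEq A₁] (hP : P.IsHermitian) (hPP : P * P = P)
    (hc : Commute (P ⊗ₖ (1 : Matrix B₁ B₁ ℂ)) σ.mat) {W : Matrix A₀ A₀ ℂ}
    (hW : W ∈ unitaryGroup A₀ ℂ) :
    Compatible (controlled W P) (1 : Matrix (A₁ × B₁) (A₁ × B₁) ℂ) σ := by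
  intro ρ
  have hW' : (W ⊗ₖ (1 : Matrix A₁ A₁ ℂ))ᴴ * (W ⊗ₖ (1 : Matrix A₁ A₁ ℂ)) = 1 :=
    mem_unitaryGroup_iff'.1 (kronecker_mem_unitary hW (one_mem _))
  rw [evolve_controlled hP hPP hc, traceLeft_add, traceLeft_kronecker, traceLeft_kronecker,
    trace_mul_comm, ← Matrix.mul_assoc, hW', one_mul, ρ.trace_eq_one, one_smul, one_smul,
    ← add_mul, add_sub_cancel, one_mul]

/-- The bit flip. -/
def bitFlip : Matrix (Fin 2) (Fin 2) ℂ := !![0, 1; 1, 0]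

theorem bitFlip_mem : bitFlip ∈ unitaryGroup (Fin 2) ℂ := by
  rw [mem_unitaryGroup_iff, star_eq_conjTranspose]
  ext i j
  fin_cases i <;> fin_cases j <;> simp [bitFlip, mul_apply]

/-- The blocks `00` and `01` are `P` and `1 - P`. In a product both would be multiples of one
unitary, but their product is zero, so one of them would vanish. -/
theorem not_isProductUnitary_controlled_bitFlip (hPP : P * P = P) (h0 : P ≠ 0) (h1 : P ≠ 1) :
    ¬ IsProductUnitary (controlled bitFlip P) := by
  rintro ⟨W, -, V, hV, h⟩
  have h00 := congr_arg (block · 0 0) h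
  have h01 := congr_arg (block · 0 1) h
  simp only [controlled, block_add, block_kronecker] at h00 h01
  simp only [bitFlip, one_apply_eq, one_smul, of_apply, cons_val', cons_val_zero, cons_val_one,
    zero_smul, add_zero, cons_val_fin_one, ne_eq, zero_ne_one, not_false_eq_true, one_apply_ne,
    zero_add] at h00 h01
  have hzero : (W 0 0 * W 0 1) • (V * V) = 0 := by
    have : P * (1 - P) = 0 := by rw [mul_sub, hPP, mul_one, sub_self]
    rwa [h01, h00, smul_mul, Matrix.mul_smul, smul_smul] at this
  have hV0 : V * V ≠ 0 := by
    intro hVV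
    have hVs := mem_unitaryGroup_iff'.1 hV
    have : V = 0 := by rw [← one_mul V, ← hVs, Matrix.mul_assoc, hVV, mul_zero]
    exact h0 (by rw [h00, this, smul_zero])
  rcases mul_eq_zero.1 ((smul_eq_zero.1 hzero).resolve_right hV0) with h' | h'
  · exact h0 (by rw [h00, h', zero_smul])
  · rw [h', zero_smul, sub_eq_zero] at h01
    exact h1 h01.symm

theorem exists_compatible_not_isProductUnitary_of_isPCQ (hσ : IsPCQ σ) :
    ∃ (U₀ : unitaryGroup (Fin 2 × B₀) ℂ) (U₁ : unitaryGroup (Fin 1 × B₁) ℂ),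
      Compatible U₀.1 U₁.1 σ ∧ ¬ IsProductUnitary U₀.1 := by
  obtain ⟨P, hP, hPP, h0, h1, hc⟩ := isPCQ_iff.1 hσ
  exact ⟨⟨controlled bitFlip P, controlled_mem_unitaryGroup hP hPP bitFlip_mem⟩, 1,
    compatible_controlled hP hPP hc bitFlip_mem,
    not_isProductUnitary_controlled_bitFlip hPP h0 h1⟩

theorem isTQTQ_of_onlyProductCompatible (h : OnlyProductCompatible σ) : IsTQTQ σ := by
  refine ⟨fun hσ => ?_, fun hσ => ?_⟩
  · obtain ⟨U₀, U₁, hU, hn⟩ := exists_compatible_not_isProductUnitary_of_isPCQ hσ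
    exact hn (h 2 1 two_pos one_pos U₀ U₁ hU).1
  · obtain ⟨U₁, U₀, hU, hn⟩ := exists_compatible_not_isProductUnitary_of_isPCQ (isQPC_iff_swap.1 hσ)
    exact hn (h 1 2 one_pos two_pos U₀ U₁ hU.swap).2

/-- The pure state `|0⟩⟨0|` of a qubit, tensored with a trivial system. -/
def groundState : State (Fin 2 × Fin 1) where
  mat := diagonal fun x => ((if x.1 = 0 then 1 else 0 : ℝ) : ℂ)
  posSemidef := PosSemidef.diagonal fun x => by
    dsimp only
    split_ifs <;> simp
  trace_eq_one := by simp [trace_diagonal, Fintype.sum_prod_type]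

/-- A projector on the first system which commutes with `σ` and has an uncertain outcome allows
to extract randomness. -/
theorem randomnessExtractable_of_projection (α : ℝ) (hP : P.IsHermitian) (hPP : P * P = P)
    (hc : Commute (P ⊗ₖ (1 : Matrix B₁ B₁ ℂ)) σ.mat) {p : ℝ}
    (hp : ((P ⊗ₖ (1 : Matrix B₁ B₁ ℂ)) * σ.mat).trace = p) (h0 : 0 < p) (h1 : p < 1) :
    RandomnessExtractable α σ := by
  refine ⟨2, 1, two_pos, one_pos,
    ⟨controlled bitFlip P, controlled_mem_unitaryGroup hP hPP bitFlip_mem⟩, 1,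
    compatible_controlled hP hPP hc bitFlip_mem, groundState, ?_⟩
  have hout : (output ⟨controlled bitFlip P, controlled_mem_unitaryGroup hP hPP bitFlip_mem⟩ 1
      groundState σ).mat = diagonal fun x => ((if x.1 = 0 then p else 1 - p : ℝ) : ℂ) := by
    simp only [output]
    rw [OneMemClass.coe_one, evolve_controlled hP hPP hc, traceRight_add, traceRight_kronecker,
      traceRight_kronecker, hp, sub_mul, trace_sub, hp, one_mul, σ.trace_eq_one]
    ext ⟨i, k⟩ ⟨j, l⟩
    fin_cases i <;> fin_cases j <;> fin_cases k <;> fin_cases l <;>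
      simp [groundState, bitFlip, mul_apply, Fintype.sum_prod_type, diagonal_apply]
  -- The input has spectrum `{1, 0}` and hence zero entropy at every order; excluding zero
  -- eigenvalues matters at `α = 0`, where `0 ^ 0 = 1`.
  rw [State.renyiEntropy_diagonal α hout, State.renyiEntropy_diagonal α (ρ := groundState) rfl]
  have h := binary_entropy_pos α h0 h1
  have h1' : (1 - p) ≠ 0 := by linarith
  simpa [Fintype.sum_prod_type, h0.ne', h1'] using h

end Controlled

/-! ### Restriction to the supports of the marginals -/

section Restriction

/-- The trace equals that of the positive operator `P†DP`, and if this vanished, `D` would have zero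
expectation on a nonzero vector in the range of `P`. -/
theorem trace_mul_pos_of_projection {X : Type*} [Fintype X] [DecidableEq X] {P D : Matrix X X ℂ}
    (hP : P.IsHermitian) (hPP : P * P = P) (h0 : P ≠ 0) (hD : D.PosDef) : 0 < (P * D).trace := by
  have htr : (P * D).trace = (Pᴴ * D * P).trace := by
    rw [trace_mul_comm (Pᴴ * D), ← Matrix.mul_assoc, hP.eq, hPP]
  have hpsd : (Pᴴ * D * P).PosSemidef := hD.posSemidef.conjTranspose_mul_mul_same P
  rw [htr]
  refine lt_of_le_of_ne hpsd.trace_nonneg fun h => ?_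
  rw [eq_comm, hpsd.trace_eq_zero_iff] at h
  refine h0 (Matrix.ext_of_mulVec_single fun i => ?_)
  by_contra hx
  rw [zero_mulVec] at hx
  have := hD.dotProduct_mulVec_pos hx
  rw [star_mulVec, mulVec_mulVec, ← dotProduct_mulVec, mulVec_mulVec, ← Matrix.mul_assoc, h,
    zero_mulVec, dotProduct_zero] at this
  exact lt_irrefl _ this

variable {X Y Z : Type*} [Fintype X] [Fintype Y] [Fintype Z] [DecidableEq X] [DecidableEq Y]
  [DecidableEq Z]

theorem traceRight_kronecker_one_mul (N : Matrix X X ℂ) (M : Matrix (X × Y) (X × Y) ℂ) :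
    traceRight ((N ⊗ₖ (1 : Matrix Y Y ℂ)) * M) = N * traceRight M := by
  ext x x'
  simp only [traceRight, of_apply, mul_apply, Fintype.sum_prod_type, kronecker_apply, one_apply,
    mul_ite, mul_one, mul_zero, ite_mul, zero_mul, Finset.mul_sum]
  rw [Finset.sum_comm]
  simp

theorem traceRight_one_kronecker_mul_comm (V : Matrix Y Z ℂ) (N : Matrix (X × Z) (X × Y) ℂ) :
    traceRight (((1 : Matrix X X ℂ) ⊗ₖ V) * N) = traceRight (N * ((1 : Matrix X X ℂ) ⊗ₖ V)) := by
  ext x x'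
  simp only [traceRight, of_apply, mul_apply, Fintype.sum_prod_type_right, kronecker_apply,
    one_apply, mul_ite, mul_zero, ite_mul, zero_mul, one_mul, Finset.sum_ite_eq,
    Finset.sum_ite_eq', Finset.mem_univ, if_true]
  rw [Finset.sum_comm]
  simp [mul_comm]

theorem traceLeft_one_kronecker_mul_mul (V : Matrix Y Z ℂ) (M : Matrix (X × Z) (X × Z) ℂ)
    (V' : Matrix Z Y ℂ) :
    traceLeft (((1 : Matrix X X ℂ) ⊗ₖ V) * M * ((1 : Matrix X X ℂ) ⊗ₖ V')) =
      V * traceLeft M * V' := by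
  have h : ∀ x y y', (((1 : Matrix X X ℂ) ⊗ₖ V) * M * ((1 : Matrix X X ℂ) ⊗ₖ V')) (x, y) (x, y') =
      (V * (M.submatrix (Prod.mk x) (Prod.mk x)) * V') y y' := by
    intro x y y'
    simp only [mul_apply, Fintype.sum_prod_type_right, kronecker_apply,
      one_apply, mul_ite, mul_zero, ite_mul, zero_mul, one_mul, Finset.sum_ite_eq,
      Finset.sum_ite_eq', Finset.mem_univ, if_true, submatrix_apply]
  have h' : traceLeft M = ∑ x, M.submatrix (Prod.mk x) (Prod.mk x) := by
    ext; simp [traceLeft, Matrix.sum_apply]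
  ext y y'
  rw [h', Matrix.mul_sum, Matrix.sum_mul, Matrix.sum_apply]
  exact Finset.sum_congr rfl fun x _ => h x y _

/-- Operators vanishing on a state with full-rank first marginal are zero. -/
theorem eq_zero_of_kronecker_mul_eq_zero {W : Type*} [Fintype W] [DecidableEq W] {τ : State (X × Y)}
    (hτ : (traceRight τ.mat).PosDef) {M : Matrix W X ℂ}
    (h : (M ⊗ₖ (1 : Matrix Y Y ℂ)) * τ.mat = 0) : M = 0 := by
  -- Passing to `M†M` gives a square operator, so the partial trace yields `M†M` times the
  -- invertible marginal.
  have h1 : ((Mᴴ * M) ⊗ₖ (1 : Matrix Y Y ℂ)) * τ.mat = 0 := by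
    rw [← mul_one (1 : Matrix Y Y ℂ), mul_kronecker_mul, Matrix.mul_assoc, h, Matrix.mul_zero]
  have h2 : Mᴴ * M * traceRight τ.mat = 0 := by
    rw [← traceRight_kronecker_one_mul, h1]
    ext; simp [traceRight]
  exact conjTranspose_mul_self_eq_zero.1 (hτ.isUnit.mul_left_eq_zero.1 h2)

theorem conjTranspose_mul_one_kronecker {V : Matrix Y Z ℂ} (hV : Vᴴ * V = 1) :
    ((1 : Matrix X X ℂ) ⊗ₖ V)ᴴ * ((1 : Matrix X X ℂ) ⊗ₖ V) = 1 := by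
  rw [conjTranspose_kronecker, ← mul_kronecker_mul, hV, conjTranspose_one, one_mul,
    one_kronecker_one]

variable {A₀ A₁ B₀ B₁ C₀ C₁ : Type*} [Fintype A₀] [Fintype A₁] [Fintype B₀] [Fintype B₁]
  [Fintype C₀] [Fintype C₁] [DecidableEq A₀] [DecidableEq A₁] [DecidableEq B₀] [DecidableEq B₁]
  [DecidableEq C₀] [DecidableEq C₁] {σ : State (B₀ × B₁)} {τ : State (C₀ × C₁)}
  {V₀ : Matrix B₀ C₀ ℂ} {V₁ : Matrix B₁ C₁ ℂ}

/-- Compatible unitaries preserve the supports of the marginals. -/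
theorem Compatible.block_preserves_support [Nonempty A₀] [Nonempty A₁]
    {U₀ : unitaryGroup (A₀ × B₀) ℂ} {U₁ : unitaryGroup (A₁ × B₁) ℂ}
    (h : Compatible U₀.1 U₁.1 σ) (hτ : (traceRight τ.mat).PosDef) (hV₀ : V₀ᴴ * V₀ = 1)
    (hV₁ : V₁ᴴ * V₁ = 1) (hσ : σ.mat = (V₀ ⊗ₖ V₁) * τ.mat * (V₀ ⊗ₖ V₁)ᴴ) (a b : A₀) :
    V₀ * V₀ᴴ * block U₀.1 a b * V₀ = block U₀.1 a b * V₀ := by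
  set K := block U₀.1 a b
  obtain ⟨d⟩ := ‹Nonempty A₁›
  have hsup : ((V₀ * V₀ᴴ) ⊗ₖ (1 : Matrix B₁ B₁ ℂ)) * σ.mat = σ.mat := by
    rw [hσ, ← Matrix.mul_assoc, ← Matrix.mul_assoc, ← mul_kronecker_mul, Matrix.one_mul,
      Matrix.mul_assoc V₀, hV₀, Matrix.mul_one]
  -- Insert `∑ L†L = 1` and move `K ⊗ L` past `σ`. With `σ` now to the left of `K`, the support
  -- projector on the first system is absorbed.
  have hKσ : (K ⊗ₖ (1 : Matrix B₁ B₁ ℂ)) * σ.mat =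
      ∑ c, ((1 : Matrix B₀ B₀ ℂ) ⊗ₖ (block U₁.1 c d)ᴴ) * (σ.mat * (K ⊗ₖ block U₁.1 c d)) := by
    rw [← sum_block_conjTranspose_mul_block (unitary_conjTranspose_mul U₁) d, kronecker_sum,
      Finset.sum_mul]
    refine Finset.sum_congr rfl fun c _ => ?_
    rw [← (h.commute_block a b c d).eq, ← Matrix.mul_assoc, ← mul_kronecker_mul, one_mul]
  have hsupK : ((V₀ * V₀ᴴ * K - K) ⊗ₖ (1 : Matrix B₁ B₁ ℂ)) * σ.mat = 0 := by
    have h1 : ((V₀ * V₀ᴴ * K) ⊗ₖ (1 : Matrix B₁ B₁ ℂ)) * σ.mat =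
        (K ⊗ₖ (1 : Matrix B₁ B₁ ℂ)) * σ.mat := by
      rw [← mul_one (1 : Matrix B₁ B₁ ℂ), mul_kronecker_mul, mul_one, Matrix.mul_assoc, hKσ,
        Finset.mul_sum]
      refine Finset.sum_congr rfl fun c _ => ?_
      rw [← Matrix.mul_assoc, ← mul_kronecker_mul, mul_one, one_mul,
        ← one_mul (V₀ * V₀ᴴ), ← mul_one (block U₁.1 c d)ᴴ, mul_kronecker_mul, Matrix.mul_assoc,
        ← Matrix.mul_assoc _ σ.mat, hsup, mul_one]
    have h2 : (V₀ * V₀ᴴ * K - K) ⊗ₖ (1 : Matrix B₁ B₁ ℂ) =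
        (V₀ * V₀ᴴ * K) ⊗ₖ (1 : Matrix B₁ B₁ ℂ) - K ⊗ₖ (1 : Matrix B₁ B₁ ℂ) := by
      rw [eq_sub_iff_add_eq, ← add_kronecker, sub_add_cancel]
    rw [h2, sub_mul, h1, sub_self]
  have hV : (V₀ ⊗ₖ V₁)ᴴ * (V₀ ⊗ₖ V₁) = 1 := by
    rw [conjTranspose_kronecker, ← mul_kronecker_mul, hV₀, hV₁, one_kronecker_one]
  -- Strip off the isometries to transfer the identity to `τ`, whose first marginal is invertible.
  have hM : (((V₀ * V₀ᴴ * K - K) * V₀) ⊗ₖ (1 : Matrix C₁ C₁ ℂ)) * τ.mat = 0 := by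
    have h1 := congr_arg (fun M => ((1 : Matrix B₀ B₀ ℂ) ⊗ₖ V₁ᴴ) * (M * (V₀ ⊗ₖ V₁))) hsupK
    simp only [hσ, Matrix.zero_mul, Matrix.mul_zero] at h1
    rw [Matrix.mul_assoc _ _ (V₀ ⊗ₖ V₁), Matrix.mul_assoc _ _ (V₀ ⊗ₖ V₁), hV, Matrix.mul_one,
      ← Matrix.mul_assoc (_ ⊗ₖ _) (V₀ ⊗ₖ V₁), ← mul_kronecker_mul, ← Matrix.mul_assoc,
      ← mul_kronecker_mul, Matrix.one_mul, Matrix.one_mul, hV₁] at h1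
    exact h1
  have := eq_zero_of_kronecker_mul_eq_zero hτ hM
  rwa [Matrix.sub_mul, sub_eq_zero] at this

/-- The compression of an operator on `A B` to the range of `V` on `B`. -/
def compress (V : Matrix B₀ C₀ ℂ) (U : Matrix (A₀ × B₀) (A₀ × B₀) ℂ) :
    Matrix (A₀ × C₀) (A₀ × C₀) ℂ :=
  ((1 : Matrix A₀ A₀ ℂ) ⊗ₖ V)ᴴ * U * ((1 : Matrix A₀ A₀ ℂ) ⊗ₖ V)

/-- Invariance of the range of `V₀` makes the embedding intertwine `U` with its compression;
unitarity and the evolution on the supports both follow from this. -/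
theorem mul_one_kronecker_eq_compress {U : Matrix (A₀ × B₀) (A₀ × B₀) ℂ} (hV : V₀ᴴ * V₀ = 1)
    (h : ∀ a b, V₀ * V₀ᴴ * block U a b * V₀ = block U a b * V₀) :
    U * ((1 : Matrix A₀ A₀ ℂ) ⊗ₖ V₀) = ((1 : Matrix A₀ A₀ ℂ) ⊗ₖ V₀) * compress V₀ U := by
  have h1 : ((1 : Matrix A₀ A₀ ℂ) ⊗ₖ (V₀ * V₀ᴴ)) * U * ((1 : Matrix A₀ A₀ ℂ) ⊗ₖ (V₀ * V₀ᴴ)) =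
      U * ((1 : Matrix A₀ A₀ ℂ) ⊗ₖ (V₀ * V₀ᴴ)) := by
    refine ext_block fun a b => ?_
    have := congr_arg (· * V₀ᴴ) (h a b)
    simp only [block_mul, block_kronecker, one_apply, ite_smul, one_smul, zero_smul, ite_mul,
      mul_ite, zero_mul, mul_zero, Finset.sum_ite_eq, Finset.sum_ite_eq', Finset.mem_univ, if_true]
    simpa only [Matrix.mul_assoc] using this
  have h2 : ((1 : Matrix A₀ A₀ ℂ) ⊗ₖ (V₀ * V₀ᴴ)) * ((1 : Matrix A₀ A₀ ℂ) ⊗ₖ V₀) =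
      (1 : Matrix A₀ A₀ ℂ) ⊗ₖ V₀ := by
    rw [← mul_kronecker_mul, Matrix.mul_assoc, hV, Matrix.one_mul, Matrix.mul_one]
  have h3 : (1 : Matrix A₀ A₀ ℂ) ⊗ₖ (V₀ * V₀ᴴ) =
      ((1 : Matrix A₀ A₀ ℂ) ⊗ₖ V₀) * ((1 : Matrix A₀ A₀ ℂ) ⊗ₖ V₀)ᴴ := by
    rw [conjTranspose_kronecker, ← mul_kronecker_mul, conjTranspose_one, one_mul]
  have h4 := congr_arg (· * ((1 : Matrix A₀ A₀ ℂ) ⊗ₖ V₀)) h1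
  simp only [Matrix.mul_assoc, h2] at h4
  rw [← h4, h3, compress]
  simp only [Matrix.mul_assoc]

theorem compress_mem_unitaryGroup (U : unitaryGroup (A₀ × B₀) ℂ) (hV : V₀ᴴ * V₀ = 1)
    (h : ∀ a b, V₀ * V₀ᴴ * block U.1 a b * V₀ = block U.1 a b * V₀) :
    compress V₀ U.1 ∈ unitaryGroup (A₀ × C₀) ℂ := by
  rw [mem_unitaryGroup_iff', star_eq_conjTranspose]
  calc (compress V₀ U.1)ᴴ * compress V₀ U.1
      = ((1 : Matrix A₀ A₀ ℂ) ⊗ₖ V₀)ᴴ * U.1ᴴ *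
        (((1 : Matrix A₀ A₀ ℂ) ⊗ₖ V₀) * compress V₀ U.1) := by
        conv_lhs => enter [1]; rw [compress]
        simp only [conjTranspose_mul, conjTranspose_conjTranspose, Matrix.mul_assoc]
    _ = ((1 : Matrix A₀ A₀ ℂ) ⊗ₖ V₀)ᴴ * (U.1ᴴ * U.1) * ((1 : Matrix A₀ A₀ ℂ) ⊗ₖ V₀) := by
        rw [← mul_one_kronecker_eq_compress hV h]
        simp only [Matrix.mul_assoc]
    _ = 1 := by
        rw [unitary_conjTranspose_mul, Matrix.mul_one, conjTranspose_mul_one_kronecker hV]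

theorem evolve_of_intertwines {U₀ : Matrix (A₀ × B₀) (A₀ × B₀) ℂ}
    {U₁ : Matrix (A₁ × B₁) (A₁ × B₁) ℂ} {u₀ : Matrix (A₀ × C₀) (A₀ × C₀) ℂ}
    {u₁ : Matrix (A₁ × C₁) (A₁ × C₁) ℂ}
    (h₀ : U₀ * ((1 : Matrix A₀ A₀ ℂ) ⊗ₖ V₀) = ((1 : Matrix A₀ A₀ ℂ) ⊗ₖ V₀) * u₀)
    (h₁ : U₁ * ((1 : Matrix A₁ A₁ ℂ) ⊗ₖ V₁) = ((1 : Matrix A₁ A₁ ℂ) ⊗ₖ V₁) * u₁)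
    (hσ : σ.mat = (V₀ ⊗ₖ V₁) * τ.mat * (V₀ ⊗ₖ V₁)ᴴ) (ρ : State (A₀ × A₁)) :
    evolve U₀ U₁ ρ σ = ((1 : Matrix (A₀ × A₁) (A₀ × A₁) ℂ) ⊗ₖ (V₀ ⊗ₖ V₁)) * evolve u₀ u₁ ρ τ *
      ((1 : Matrix (A₀ × A₁) (A₀ × A₁) ℂ) ⊗ₖ (V₀ ⊗ₖ V₁)ᴴ) := by
  set F := (1 : Matrix (A₀ × A₁) (A₀ × A₁) ℂ) ⊗ₖ (V₀ ⊗ₖ V₁) with hF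
  have hFH : (1 : Matrix (A₀ × A₁) (A₀ × A₁) ℂ) ⊗ₖ (V₀ ⊗ₖ V₁)ᴴ = Fᴴ := by
    rw [hF, conjTranspose_kronecker 1, conjTranspose_one]
  have hF' : F = (((1 : Matrix A₀ A₀ ℂ) ⊗ₖ V₀) ⊗ₖ ((1 : Matrix A₁ A₁ ℂ) ⊗ₖ V₁)).submatrix
      (Equiv.prodProdProdComm A₀ A₁ B₀ B₁) (Equiv.prodProdProdComm A₀ A₁ C₀ C₁) := by
    ext ⟨⟨_, _⟩, _, _⟩ ⟨⟨_, _⟩, _, _⟩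
    rw [hF, ← one_kronecker_one]
    exact mul_mul_mul_comm _ _ _ _
  have hJ : jointOp U₀ U₁ * F = F * jointOp u₀ u₁ := by
    rw [hF', jointOp, jointOp, submatrix_mul_equiv, submatrix_mul_equiv, ← mul_kronecker_mul,
      ← mul_kronecker_mul, h₀, h₁]
  have hρσ : ρ.mat ⊗ₖ σ.mat = F * (ρ.mat ⊗ₖ τ.mat) * Fᴴ := by
    rw [hσ, ← hFH, hF, ← mul_kronecker_mul, ← mul_kronecker_mul, one_mul, mul_one]
  rw [hFH, evolve, evolve, hρσ]
  calc jointOp U₀ U₁ * (F * (ρ.mat ⊗ₖ τ.mat) * Fᴴ) * (jointOp U₀ U₁)ᴴ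
      = (jointOp U₀ U₁ * F) * (ρ.mat ⊗ₖ τ.mat) * (jointOp U₀ U₁ * F)ᴴ := by
        simp only [conjTranspose_mul, Matrix.mul_assoc]
    _ = _ := by
        rw [hJ]
        simp only [conjTranspose_mul, Matrix.mul_assoc]

theorem swap_mat_eq (hσ : σ.mat = (V₀ ⊗ₖ V₁) * τ.mat * (V₀ ⊗ₖ V₁)ᴴ) :
    σ.swap.mat = (V₁ ⊗ₖ V₀) * τ.swap.mat * (V₁ ⊗ₖ V₀)ᴴ := by
  have hV : V₁ ⊗ₖ V₀ = (V₀ ⊗ₖ V₁).submatrix (Equiv.prodComm B₁ B₀) (Equiv.prodComm C₁ C₀) := by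
    ext; simp [mul_comm]
  have hτs : τ.swap.mat = τ.mat.submatrix (Equiv.prodComm C₁ C₀) (Equiv.prodComm C₁ C₀) := rfl
  rw [hV, hτs, conjTranspose_submatrix, submatrix_mul_equiv, submatrix_mul_equiv, ← hσ]
  rfl

theorem IsRestrictionToSupports.swap (h : IsRestrictionToSupports τ σ) :
    IsRestrictionToSupports τ.swap σ.swap := by
  obtain ⟨hτ, V₀, V₁, hV₀, hV₁, hσ⟩ := h
  exact ⟨⟨hτ.2, hτ.1⟩, V₁, V₀, hV₁, hV₀, swap_mat_eq hσ⟩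

theorem IsRestrictionToSupports.refl (h : LocallyFullRank σ) : IsRestrictionToSupports σ σ :=
  ⟨h, 1, 1, by simp, by simp, by simp⟩

/-- Compatible unitaries of `σ` restrict to the supports of the marginals. -/
theorem RandomnessExtractable.restrict {α : ℝ} (hτσ : IsRestrictionToSupports τ σ)
    (h : RandomnessExtractable α σ) : RandomnessExtractable α τ := by
  obtain ⟨hτ, V₀, V₁, hV₀, hV₁, hσ⟩ := hτσ
  obtain ⟨a₀, a₁, h₀, h₁, U₀, U₁, hU, ρ, hρ⟩ := h
  have : Nonempty (Fin a₀) := ⟨⟨0, h₀⟩⟩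
  have : Nonempty (Fin a₁) := ⟨⟨0, h₁⟩⟩
  have hs₀ := hU.block_preserves_support hτ.1 hV₀ hV₁ hσ
  have hs₁ := hU.swap.block_preserves_support (τ := τ.swap) hτ.2 hV₁ hV₀ (swap_mat_eq hσ)
  have hev := evolve_of_intertwines (mul_one_kronecker_eq_compress hV₀ hs₀)
    (mul_one_kronecker_eq_compress hV₁ hs₁) hσ
  have hV : (V₀ ⊗ₖ V₁)ᴴ * (V₀ ⊗ₖ V₁) = 1 := by
    rw [conjTranspose_kronecker, ← mul_kronecker_mul, hV₀, hV₁, one_kronecker_one]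
  refine ⟨a₀, a₁, h₀, h₁, ⟨_, compress_mem_unitaryGroup U₀ hV₀ hs₀⟩,
    ⟨_, compress_mem_unitaryGroup U₁ hV₁ hs₁⟩, fun ρ => ?_, ρ, ?_⟩
  · have h1 := hU ρ
    rw [hev, traceLeft_one_kronecker_mul_mul, hσ] at h1
    have h2 := congr_arg (fun M => (V₀ ⊗ₖ V₁)ᴴ * M * (V₀ ⊗ₖ V₁)) h1
    have hcancel : ∀ M : Matrix (C₀ × C₁) (C₀ × C₁) ℂ,
        (V₀ ⊗ₖ V₁)ᴴ * ((V₀ ⊗ₖ V₁) * M * (V₀ ⊗ₖ V₁)ᴴ) * (V₀ ⊗ₖ V₁) = M := by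
      intro M
      rw [Matrix.mul_assoc, Matrix.mul_assoc _ _ (V₀ ⊗ₖ V₁), hV, Matrix.mul_one,
        ← Matrix.mul_assoc, hV, Matrix.one_mul]
    simpa only [hcancel] using h2
  -- Cyclicity of the partial trace cancels the isometries on the source, so both sources produce
  -- the same output.
  · refine hρ.trans_eq (State.renyiEntropy_congr α (congr_arg Matrix.charpoly ?_))
    simp only [output]
    rw [hev, Matrix.mul_assoc, traceRight_one_kronecker_mul_comm, Matrix.mul_assoc,
      ← mul_kronecker_mul, hV, one_mul, one_kronecker_one, mul_one]

/-- The control projector is `V₀ P V₀†`. Both `P` and `1 - P` have positive weight in the full-rank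
marginal of `τ`, so the outcome is uncertain. -/
theorem randomnessExtractable_of_isPCQ_restriction (α : ℝ) (hτσ : IsRestrictionToSupports τ σ)
    (h : IsPCQ τ) : RandomnessExtractable α σ := by
  obtain ⟨hτ, V₀, V₁, hV₀, hV₁, hσ⟩ := hτσ
  obtain ⟨P, hP, hPP, h0, h1, hc⟩ := isPCQ_iff.1 h
  have hpos := trace_mul_pos_of_projection hP hPP h0 hτ.1
  have hpos' := trace_mul_pos_of_projection (isHermitian_one.sub hP) (P := 1 - P)
    (by simp [mul_sub, sub_mul, hPP]) (sub_ne_zero.2 h1.symm) hτ.1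
  rw [sub_mul, one_mul, trace_sub, trace_traceRight, τ.trace_eq_one] at hpos'
  obtain ⟨p, hp⟩ : ∃ p : ℝ, (p : ℂ) = (P * traceRight τ.mat).trace :=
    ⟨_, (Complex.eq_re_of_ofReal_le hpos.le).symm⟩
  rw [← hp] at hpos hpos'
  have hp0 : 0 < p := by exact_mod_cast hpos
  have hp1 : p < 1 := by
    have : 0 < 1 - p := by exact_mod_cast hpos'
    linarith
  have hV : (V₀ ⊗ₖ V₁)ᴴ * (V₀ ⊗ₖ V₁) = 1 := by
    rw [conjTranspose_kronecker, ← mul_kronecker_mul, hV₀, hV₁, one_kronecker_one]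
  have hl : ((V₀ * P * V₀ᴴ) ⊗ₖ (1 : Matrix B₁ B₁ ℂ)) * (V₀ ⊗ₖ V₁) =
      (V₀ ⊗ₖ V₁) * (P ⊗ₖ (1 : Matrix C₁ C₁ ℂ)) := by
    rw [← mul_kronecker_mul, ← mul_kronecker_mul, Matrix.mul_assoc, hV₀, Matrix.mul_one,
      Matrix.one_mul, Matrix.mul_one]
  have hr : (V₀ ⊗ₖ V₁)ᴴ * ((V₀ * P * V₀ᴴ) ⊗ₖ (1 : Matrix B₁ B₁ ℂ)) =
      (P ⊗ₖ (1 : Matrix C₁ C₁ ℂ)) * (V₀ ⊗ₖ V₁)ᴴ := by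
    rw [conjTranspose_kronecker, ← mul_kronecker_mul, ← mul_kronecker_mul, ← Matrix.mul_assoc,
      ← Matrix.mul_assoc, hV₀, Matrix.one_mul, Matrix.one_mul, Matrix.mul_one]
  have hlσ : ((V₀ * P * V₀ᴴ) ⊗ₖ (1 : Matrix B₁ B₁ ℂ)) * σ.mat =
      (V₀ ⊗ₖ V₁) * ((P ⊗ₖ (1 : Matrix C₁ C₁ ℂ)) * τ.mat) * (V₀ ⊗ₖ V₁)ᴴ := by
    rw [hσ, ← Matrix.mul_assoc, ← Matrix.mul_assoc, hl]
    simp only [Matrix.mul_assoc]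
  refine randomnessExtractable_of_projection α (P := V₀ * P * V₀ᴴ)
    (isHermitian_mul_mul_conjTranspose V₀ hP) ?_ ?_ (p := p) ?_ hp0 hp1
  · calc V₀ * P * V₀ᴴ * (V₀ * P * V₀ᴴ) = V₀ * (P * (V₀ᴴ * V₀) * P) * V₀ᴴ := by
          simp only [Matrix.mul_assoc]
      _ = V₀ * P * V₀ᴴ := by rw [hV₀, Matrix.mul_one, hPP]
  · refine hlσ.trans ?_
    rw [hc.eq, hσ, Matrix.mul_assoc _ _ (_ ⊗ₖ (1 : Matrix B₁ B₁ ℂ)), hr]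
    simp only [Matrix.mul_assoc]
  · rw [hlσ, trace_mul_comm, ← Matrix.mul_assoc, hV, Matrix.one_mul, trace_kronecker_one_mul, hp]

theorem not_randomnessExtractable_iff_isTQTQ_restriction (α : ℝ)
    (hτσ : IsRestrictionToSupports τ σ) : ¬ RandomnessExtractable α σ ↔ IsTQTQ τ := by
  refine ⟨fun h => ⟨fun hτ => ?_, fun hτ => ?_⟩, fun h hσ => ?_⟩
  · exact h (randomnessExtractable_of_isPCQ_restriction α hτσ hτ)
  · exact h (randomnessExtractable_of_isPCQ_restriction α hτσ.swap (isQPC_iff_swap.1 hτ)).swap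
  · exact not_randomnessExtractable_of_isTQTQ α h (hσ.restrict hτσ)

end Restriction

/-! ### A mixed state without extractable randomness -/

section Isotropic

/-- The unnormalized maximally entangled vector `|00⟩ + |11⟩`. -/
def bellVector : Fin 2 × Fin 2 → ℂ := fun x => if x.1 = x.2 then 1 else 0

/-- The two-qubit isotropic state `½ |Φ⟩⟨Φ| + ½ · 𝟙/4`. -/
noncomputable def isotropicState : State (Fin 2 × Fin 2) where
  mat := (1 / 4 : ℂ) • vecMulVec bellVector (star bellVector) + (1 / 8 : ℂ) • 1
  posSemidef := ((posSemidef_vecMulVec_self_star _).smul (by positivity)).add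
    (PosSemidef.one.smul (by positivity))
  trace_eq_one := by
    simp [Matrix.trace, Fintype.sum_prod_type, vecMulVec_apply, bellVector]
    norm_num

theorem not_isPure_isotropicState : ¬ isotropicState.IsPure := by
  rintro ⟨ψ, h⟩
  -- In a pure state, the vanishing coherence between `01` and `10` would force one of their
  -- populations to vanish, yet both equal 1/8.
  have h1 := congr_fun₂ h (0, 1) (0, 1)
  have h2 := congr_fun₂ h (0, 1) (1, 0)
  have h3 := congr_fun₂ h (1, 0) (1, 0)
  simp [isotropicState, vecMulVec_apply, bellVector] at h1 h2 h3
  rcases h2 with h2 | h2 <;> simp [h2] at h1 h3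

theorem traceRight_isotropicState : traceRight isotropicState.mat = (1 / 2 : ℂ) • 1 := by
  ext i j
  fin_cases i <;> fin_cases j <;>
    simp [isotropicState, traceRight, vecMulVec_apply, bellVector, one_apply] <;> norm_num

theorem swap_isotropicState : isotropicState.swap = isotropicState := by
  have h : isotropicState.swap.mat = isotropicState.mat := by
    ext ⟨i, j⟩ ⟨k, l⟩
    fin_cases i <;> fin_cases j <;> fin_cases k <;> fin_cases l <;>
      simp [isotropicState, State.swap, vecMulVec_apply, bellVector, one_apply]
  revert h
  generalize isotropicState.swap = σ
  generalize isotropicState = τ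
  intro h
  cases σ
  cases τ
  congr

theorem locallyFullRank_isotropicState : LocallyFullRank isotropicState := by
  have h : (traceRight isotropicState.mat).PosDef := by
    rw [traceRight_isotropicState]
    exact PosDef.one.smul (by positivity)
  refine ⟨h, ?_⟩
  rwa [← traceRight_swap, swap_isotropicState]

theorem not_isPCQ_isotropicState : ¬ IsPCQ isotropicState := by
  intro h
  obtain ⟨P, hP, hPP, h0, h1, hc⟩ := isPCQ_iff.1 h
  -- The white noise drops out of the commutator. These entries of the Bell part force equal
  -- diagonal entries of `P` and kill the off-diagonal ones.
  have e1 := congr_fun₂ hc.eq (0, 0) (1, 1)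
  have e2 := congr_fun₂ hc.eq (1, 0) (0, 0)
  have e3 := congr_fun₂ hc.eq (0, 1) (0, 0)
  simp [isotropicState, mul_apply, Fintype.sum_prod_type, vecMulVec_apply, bellVector,
    one_apply] at e1 e2 e3
  obtain ⟨c, rfl⟩ : ∃ c : ℂ, P = c • 1 := by
    refine ⟨P 0 0, ?_⟩
    have e1' : P 1 1 = P 0 0 := by linear_combination -4 * e1
    have e2' : P 1 0 = 0 := by linear_combination 4 * e2
    ext i j
    fin_cases i <;> fin_cases j <;> simp [e1', e2', e3]
  have hcc : c * c = c := by simpa using congr_fun₂ hPP 0 0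
  rcases IsIdempotentElem.iff_eq_zero_or_one.1 hcc with rfl | rfl
  · simp at h0
  · simp at h1

theorem isTQTQ_isotropicState : IsTQTQ isotropicState := by
  refine ⟨not_isPCQ_isotropicState, ?_⟩
  rw [isQPC_iff_swap, swap_isotropicState]
  exact not_isPCQ_isotropicState

end Isotropic

end CatalyticRandomness

theorem mainTheorem2 :
    -- every compatible interaction is a product one iff the source is TQ-TQ
    (∀ (B₀ B₁ : Type*) [Fintype B₀] [Fintype B₁] [DecidableEq B₀] [DecidableEq B₁]
      (σ : CatalyticRandomness.State (B₀ × B₁)),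
      CatalyticRandomness.OnlyProductCompatible σ ↔ CatalyticRandomness.IsTQTQ σ) ∧
    -- no entropy can be extracted iff the source is TQ-TQ
    (∀ (B₀ B₁ : Type*) [Fintype B₀] [Fintype B₁] [DecidableEq B₀] [DecidableEq B₁]
      (σ : CatalyticRandomness.State (B₀ × B₁)),
      CatalyticRandomness.LocallyFullRank σ → ∀ α : ℝ, 0 ≤ α →
        (¬ CatalyticRandomness.RandomnessExtractable α σ ↔ CatalyticRandomness.IsTQTQ σ)) ∧
    -- the same for arbitrary sources, restricted to the supports of the marginals
    (∀ (B₀ B₁ C₀ C₁ : Type*) [Fintype B₀] [Fintype B₁] [DecidableEq B₀] [DecidableEq B₁]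
      [Fintype C₀] [Fintype C₁] [DecidableEq C₀] [DecidableEq C₁]
      (σ : CatalyticRandomness.State (B₀ × B₁)) (τ : CatalyticRandomness.State (C₀ × C₁)),
      CatalyticRandomness.IsRestrictionToSupports τ σ → ∀ α : ℝ, 0 ≤ α →
        (¬ CatalyticRandomness.RandomnessExtractable α σ ↔ CatalyticRandomness.IsTQTQ τ)) ∧
    -- some mixed states are useless as catalytic randomness sources
    (∃ σ : CatalyticRandomness.State (Fin 2 × Fin 2),
      ¬ σ.IsPure ∧ CatalyticRandomness.LocallyFullRank σ ∧
        ∀ α : ℝ, 0 ≤ α → ¬ CatalyticRandomness.RandomnessExtractable α σ) :=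
  ⟨fun _ _ _ _ _ _ _ => ⟨CatalyticRandomness.isTQTQ_of_onlyProductCompatible,
      CatalyticRandomness.onlyProductCompatible_of_isTQTQ⟩,
    fun _ _ _ _ _ _ _ hσ α _ =>
      CatalyticRandomness.not_randomnessExtractable_iff_isTQTQ_restriction α (.refl hσ),
    fun _ _ _ _ _ _ _ _ _ _ _ _ _ _ h α _ =>
      CatalyticRandomness.not_randomnessExtractable_iff_isTQTQ_restriction α h,
    CatalyticRandomness.isotropicState, CatalyticRandomness.not_isPure_isotropicState,
    CatalyticRandomness.locallyFullRank_isotropicState, fun α _ =>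
      CatalyticRandomness.not_randomnessExtractable_of_isTQTQ α
        CatalyticRandomness.isTQTQ_isotropicState⟩
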